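/- Let $p$ be a prime and $G$ a profinite group. An action of $G$ is called naive if an open subgroup of $G$ acts trivially. All actions below are naive, and all group cohomology is continuous cohomology with discrete coefficients. $\mathbf W_2$ denotes $p$-typical Witt vectors of length two. $G$ is $(1,1)$-smooth (at $p$) if the following holds. For every perfect $\mathbb F_p$-algebra $A$ with an action of $G$, every locally free $A$-module $L_1$ of rank one with a semilinear action of $G$, and every class $c\in H^1(G,L_1)$, there is a $\mathbf W_2(A)$-module $L_2$, locally free of rank one, with a semilinear action of $G$, together with a $G$-equivariant isomorphism $L_2\otimes_{\mathbf W_2(A)}A\simeq L_1$, such that $c$ lies in the image of the induced map $H^1(G,L_2)\to H^1(G,L_1)$. A $G$-scheme is a quasi-compact scheme $S$ with an action of $G$ that is covered by $G$-invariant affine open subschemes. Put $\mathcal R=\mathcal O_S$ or, if $S$ is of characteristic $p$, $\mathcal R=\mathbf W_2(\mathcal O_S)$ (the sheaf $U\mapsto \mathbf W_2(\mathcal O_S(U))$). A $G$-vector bundle (for $\mathcal R=\mathcal O_S$), respectively $(G,\mathbf W_2)$-bundle (for $\mathcal R=\mathbf W_2(\mathcal O_S)$), is a sheaf of $\mathcal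 R$-modules, locally free of finite constant rank, with a semilinear action of $G$. It is called a line bundle if the rank is one. Extensions are short exact sequences with $G$-equivariant $\mathcal R$-linear maps. An extension $0\to L\to E\to\mathcal R\to 0$ is geometrically split if $E\to\mathcal R$ has an $\mathcal R$-linear, not necessarily $G$-equivariant, section. A lift of a $G$-vector bundle $M_1$ is a $(G,\mathbf W_2)$-bundle $M_2$ with a $G$-equivariant isomorphism $M_2\otimes_{\mathbf W_2(\mathcal O_S)}\mathcal O_S\simeq M_1$. Assume that $G$ is $(1,1)$-smooth. Let $S$ be a $G$-scheme of characteristic $p$ that is perfect (its absolute Frobenius is an isomorphism). Let $$\mathcal E_1:\ 0\to L_1\to E_1\to\mathcal O_S\to 0$$ be a geometrically split extension of $G$-vector bundles over $S$, with $L_1$ a line bundle. Then there exist a $(G,\mathbf W_2)$-line bundle $L_2$ lifting $L_1$ and a geometrically split extension of $(G,\mathbf W_2)$-bundles $$\mathcal E_2:\ 0\to L_2\to E_2\to\mathbf W_2(\mathcal O_S)\to 0$$ lifting $\mathcal E_1$: here $E_2$ is a lift of $E_1$, and the reduction maps $L_2\to L_1$ (that of the given lift), $E_2\to E_1$ and $\mathbf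 W_2(\mathcal O_S)\to\mathcal O_S$ (the canonical one) form a morphism of extensions $\mathcal E_2\to\mathcal E_1$. -/

import Mathlib

open CategoryTheory AlgebraicGeometry Opposite TopologicalSpace

universe v u

noncomputable section

namespace GWitt

/-! ### Extension of scalars -/

/-- Let `φ : R → R'` be a ring homomorphism. A `φ`-semilinear map `π : M → N` exhibits the
`R'`-module `N` as the extension of scalars of the `R`-module `M` if the induced `R'`-linear map
`R' ⊗[R] M → N` is an isomorphism. -/
def IsScalarExtension {R R' : Type*} [CommRing R] [CommRing R'] (φ : R →+* R')
    {M N : Type*} [AddCommGroup M] [Module R M] [AddCommGroup N] [Module R' N]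
    (π : M →ₛₗ[φ] N) : Prop :=
  letI : Algebra R R' := φ.toAlgebra
  letI : Module R N := Module.compHom N φ
  haveI : IsScalarTower R R' N := ⟨fun r r' x => mul_smul (φ r) r' x⟩
  IsBaseChange R' ({ toFun := π, map_add' := map_add π, map_smul' := map_smulₛₗ π } : M →ₗ[R] N)

/-! ### Witt vectors of length two -/

section Witt

variable (p : ℕ) [Fact p.Prime]

/-- The ring of `p`-typical Witt vectors of length two. -/
abbrev W₂ (A : Type u) : Type u := TruncatedWittVector p 2 A

/-- The functoriality of Witt vectors of length two: `(a₀, a₁) ↦ (f a₀, f a₁)`. -/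
def W₂map {A B : Type u} [CommRing A] [CommRing B] (f : A →+* B) : W₂ p A →+* W₂ p B :=
  have key (x : WittVector p A) :
      TruncatedWittVector.mk p (fun i => f ((WittVector.truncate 2 x).coeff i)) =
        WittVector.truncate 2 (WittVector.map f x) := by
    ext i; simp
  { toFun := fun x => TruncatedWittVector.mk p fun i => f (x.coeff i)
    map_one' := by
      have := key 1
      simpa only [map_one] using this
    map_zero' := by
      have := key 0
      simpa only [map_zero] using this
    map_mul' := fun x y => by
      obtain ⟨x, rfl⟩ := WittVector.truncate_surjective p 2 A x
      obtain ⟨y, rfl⟩ := WittVector.truncate_surjective p 2 A y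
      rw [← map_mul, key, key, key, ← map_mul, ← map_mul]
    map_add' := fun x y => by
      obtain ⟨x, rfl⟩ := WittVector.truncate_surjective p 2 A x
      obtain ⟨y, rfl⟩ := WittVector.truncate_surjective p 2 A y
      rw [← map_add, key, key, key, ← map_add, ← map_add] }

theorem W₂map_coeff {A B : Type u} [CommRing A] [CommRing B] (f : A →+* B) (x : W₂ p A)
    (i : Fin 2) : (W₂map p f x).coeff i = f (x.coeff i) :=
  TruncatedWittVector.coeff_mk _ _

/-- The reduction `W₂(A) → W₁(A) = A`, `(a₀, a₁) ↦ a₀`. -/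
def W₂red (A : Type u) [CommRing A] : W₂ p A →+* A :=
  have key (x : WittVector p A) :
      (WittVector.truncate 2 x).coeff 0 = WittVector.constantCoeff x := by
    simp
  { toFun := fun x => x.coeff 0
    map_one' := by
      have := key 1
      simpa only [map_one] using this
    map_zero' := by
      have := key 0
      simpa only [map_zero] using this
    map_mul' := fun x y => by
      obtain ⟨x, rfl⟩ := WittVector.truncate_surjective p 2 A x
      obtain ⟨y, rfl⟩ := WittVector.truncate_surjective p 2 A y
      rw [← map_mul, key, key, key, map_mul]
    map_add' := fun x y => by
      obtain ⟨x, rfl⟩ := WittVector.truncate_surjective p 2 A x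
      obtain ⟨y, rfl⟩ := WittVector.truncate_surjective p 2 A y
      rw [← map_add, key, key, key, map_add] }

/-- Witt vectors of length two, as a functor on commutative rings. -/
def W₂functor : CommRingCat.{u} ⥤ CommRingCat.{u} where
  obj A := CommRingCat.of (W₂ p A)
  map f := CommRingCat.ofHom (W₂map p f.hom)
  map_id A := by
    refine CommRingCat.hom_ext (RingHom.ext fun x => ?_)
    refine TruncatedWittVector.ext (p := p) fun i => ?_
    exact W₂map_coeff p _ _ _
  map_comp f g := by
    refine CommRingCat.hom_ext (RingHom.ext fun x => ?_)
    refine TruncatedWittVector.ext (p := p) fun i => ?_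
    change (W₂map p _ _).coeff i = (W₂map p _ (W₂map p _ _)).coeff i
    rw [W₂map_coeff, W₂map_coeff, W₂map_coeff]
    rfl

/-- If `F` is a sheaf of commutative rings, then so is `U ↦ W₂(F(U))`. -/
theorem W₂_isSheaf {X : TopCat.{u}} (F : TopCat.Presheaf CommRingCat.{u} X) (hF : F.IsSheaf) :
    TopCat.Presheaf.IsSheaf (C := CommRingCat.{u}) (X := X) (F ⋙ W₂functor p) := by
  rw [TopCat.Presheaf.isSheaf_iff_isSheafUniqueGluing]
  intro ι U sf hsf
  have hc (i : Fin 2) : ∃! s : F.obj (op (iSup U)),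
      TopCat.Presheaf.IsGluing F U (fun k => TruncatedWittVector.coeff (p := p) i (sf k)) s := by
    refine TopCat.Presheaf.IsSheaf.isSheafUniqueGluing hF U _ ?_
    intro k l
    have h := congrArg (TruncatedWittVector.coeff (p := p) i) (hsf k l)
    exact ((W₂map_coeff p _ _ i).symm.trans h).trans (W₂map_coeff p _ _ i)
  choose s hs huniq using hc
  refine ⟨TruncatedWittVector.mk p s, ?_, ?_⟩
  · intro k
    refine TruncatedWittVector.ext (p := p) fun i => ?_
    refine (W₂map_coeff p _ _ i).trans ?_
    rw [TruncatedWittVector.coeff_mk]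
    exact hs i k
  · intro t ht
    refine TruncatedWittVector.ext (p := p) fun i => ?_
    rw [TruncatedWittVector.coeff_mk]
    refine huniq i _ fun k => ?_
    exact (W₂map_coeff p _ _ i).symm.trans (congrArg (TruncatedWittVector.coeff (p := p) i) (ht k))

end Witt

/-! ### Continuous group cohomology in degree one, and `(1,1)`-smoothness -/

section Smooth

variable (G : Type v) [Group G] [TopologicalSpace G]

/-- An action of a topological group on a set is naive if its kernel is open, i.e. if some open
subgroup acts trivially. -/
def IsNaive (X : Type*) [SMul G X] : Prop :=
  ∃ N : OpenSubgroup G, ∀ g ∈ N, ∀ x : X, g • x = x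

/-- Continuous crossed homomorphisms `G → M`, where `M` is discrete. -/
def Z1 (M : Type*) [AddCommGroup M] [DistribMulAction G M] : AddSubgroup (G → M) where
  carrier := {c | IsLocallyConstant c ∧ ∀ g h, c (g * h) = c g + g • c h}
  zero_mem' := ⟨IsLocallyConstant.const 0, fun g h => by simp⟩
  add_mem' := fun {c d} hc hd => ⟨hc.1.add hd.1, fun g h => by
    simp only [Pi.add_apply, hc.2 g h, hd.2 g h, smul_add]; abel⟩
  neg_mem' := fun {c} hc => ⟨hc.1.neg, fun g h => by
    simp only [Pi.neg_apply, hc.2 g h, smul_neg]; abel⟩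

/-- Principal crossed homomorphisms `g ↦ g • m - m`. -/
def B1 (M : Type*) [AddCommGroup M] [DistribMulAction G M] : AddSubgroup (G → M) where
  carrier := {c | ∃ m : M, ∀ g, c g = g • m - m}
  zero_mem' := ⟨0, fun g => by simp⟩
  add_mem' := fun {c d} ⟨m, hm⟩ ⟨n, hn⟩ => ⟨m + n, fun g => by
    simp only [Pi.add_apply, hm g, hn g, smul_add]; abel⟩
  neg_mem' := fun {c} ⟨m, hm⟩ => ⟨-m, fun g => by
    simp only [Pi.neg_apply, hm g, smul_neg]; abel⟩

/-- The first cohomology group `H¹(G, M)` of a discrete `G`-module. -/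
abbrev H1 (M : Type*) [AddCommGroup M] [DistribMulAction G M] : Type _ :=
  Z1 G M ⧸ (B1 G M).addSubgroupOf (Z1 G M)

/-- The map `H¹(G, M) → H¹(G, N)` induced by a `G`-equivariant additive map. -/
def H1map {M N : Type*} [AddCommGroup M] [DistribMulAction G M] [AddCommGroup N]
    [DistribMulAction G N] (π : M →+ N) (hπ : ∀ (g : G) (x : M), π (g • x) = g • π x) :
    H1 G M →+ H1 G N :=
  QuotientAddGroup.map _ _
    { toFun := fun c => ⟨fun g => π (c.1 g), c.2.1.comp π, fun g h => by
        change π (c.1 (g * h)) = π (c.1 g) + g • π (c.1 h)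
        rw [c.2.2 g h, map_add, hπ]⟩
      map_zero' := Subtype.ext (funext fun g => map_zero π)
      map_add' := fun c d => Subtype.ext (funext fun g => map_add π _ _) }
    (by
      rintro c ⟨m, hm⟩
      refine ⟨π m, fun g => ?_⟩
      have := congrArg π (hm g)
      rwa [map_sub, hπ] at this)

/-- `(1,1)`-smoothness of a profinite group `G`, at the prime `p`: for every perfect
`𝔽_p`-algebra `A` with a naive action of `G`, every invertible (i.e. locally free of rank one)
`A`-module `L₁` with a naive semilinear action of `G` and every class `c ∈ H¹(G, L₁)`, there is a
lift `π : L₂ → L₁` of `L₁` to an invertible `W₂(A)`-module with a naive semilinear action of `G`,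
such that `c` is in the image of `H¹(G, L₂) → H¹(G, L₁)`. -/
def IsOneOneSmooth (p : ℕ) [Fact p.Prime] : Prop :=
  ∀ (A : Type u) [CommRing A] [Algebra (ZMod p) A] [MulSemiringAction G A],
    Function.Bijective (fun a : A => a ^ p) → IsNaive G A →
  ∀ (L₁ : Type u) [AddCommGroup L₁] [Module A L₁] [Module.Invertible A L₁]
    [DistribMulAction G L₁],
    (∀ (g : G) (a : A) (x : L₁), g • (a • x) = (g • a) • (g • x)) → IsNaive G L₁ →
  ∀ c : H1 G L₁,
  ∃ (L₂ : Type u) (_ : AddCommGroup L₂) (_ : Module (W₂ p A) L₂) (_ : DistribMulAction G L₂)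
    (π : L₂ →ₛₗ[W₂red p A] L₁) (hπ : ∀ (g : G) (x : L₂), π (g • x) = g • π x),
    Module.Invertible (W₂ p A) L₂ ∧
    (∀ (g : G) (a : W₂ p A) (x : L₂),
      g • (a • x) = W₂map p (MulSemiringAction.toRingHom G A g) a • (g • x)) ∧
    IsNaive G L₂ ∧
    IsScalarExtension (W₂red p A) π ∧
    c ∈ Set.range (H1map G π.toAddMonoidHom hπ)

end Smooth

/-! ### `G`-schemes and `G`-sheaves of rings -/

section Schemes

variable (G : Type v) [Group G] [TopologicalSpace G]

/-- A `G`-scheme: a quasi-compact scheme with a naive action of `G`, which is covered by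
`G`-invariant affine open subschemes. -/
structure GScheme where
  /-- the underlying scheme -/
  X : Scheme.{u}
  /-- the action of `G` -/
  ρ : G →* Aut X
  naive : ∃ N : OpenSubgroup G, ∀ g ∈ N, ρ g = 1
  quasiCompact : CompactSpace X
  invariantAffineCover : ∀ x : X, ∃ U : X.Opens,
    x ∈ U ∧ IsAffineOpen U ∧ ∀ g : G, (ρ g).inv ⁻¹ᵁ U = U

variable {G}

/-- The translate `gU` of an open `U` by `g ∈ G`: the preimage of `U` under the action
of `g⁻¹`. -/
def GScheme.translate (S : GScheme.{v, u} G) (g : G) (U : S.X.Opens) : S.X.Opens :=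
  (S.ρ g).inv ⁻¹ᵁ U

/-- The scheme `S` is of characteristic `p`. -/
def GScheme.IsOfChar (S : GScheme.{v, u} G) (p : ℕ) : Prop :=
  ∀ U : S.X.Opens, (p : Γ(S.X, U)) = 0

/-- A scheme of characteristic `p` is perfect if its absolute Frobenius, which is the identity
on the space and `a ↦ a ^ p` on functions, is an isomorphism. -/
def GScheme.IsPerfect (S : GScheme.{v, u} G) (p : ℕ) : Prop :=
  ∀ U : S.X.Opens, Function.Bijective (fun a : Γ(S.X, U) => a ^ p)

/-- A sheaf of commutative rings `R` on (the topological space of) a `G`-scheme, with an action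
of `G` compatible with the action on the space. The action of `g` is given by ring
homomorphisms `R(U) → R(gU)` compatible with restrictions; it is recorded through the composites
`R(U) → R(gU) → R(V)`, for all opens `V ⊆ gU`. Compatibility with restrictions is the
case `g = 1` or `h = 1` of `act_mul`. -/
structure GRing (S : GScheme.{v, u} G) where
  /-- the sheaf of rings -/
  R : TopCat.Sheaf CommRingCat.{u} S.X
  /-- the action of `G` -/
  act (g : G) (U V : S.X.Opens) (h : V ≤ S.translate g U) : R.obj.obj (op U) →+* R.obj.obj (op V)
  act_one (U V : S.X.Opens) (hVU : V ≤ U) (h : V ≤ S.translate 1 U) (a : R.obj.obj (op U)) :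
    act 1 U V h a = R.obj.map (homOfLE hVU).op a
  act_mul (g h : G) (U V W : S.X.Opens) (h₁ : V ≤ S.translate h U) (h₂ : W ≤ S.translate g V)
    (h₃ : W ≤ S.translate (g * h) U) (a : R.obj.obj (op U)) :
    act (g * h) U W h₃ a = act g V W h₂ (act h U V h₁ a)

/-- The sections `R(U)`. -/
abbrev GRing.sec {S : GScheme.{v, u} G} (𝓡 : GRing S) (U : S.X.Opens) : Type u :=
  𝓡.R.obj.obj (op U)

/-- The structure sheaf `𝒪_S`, with its action of `G`: a function `a` on `U` is sent to the
function `a ∘ g⁻¹` on `gU`. -/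
def structureSheaf (S : GScheme.{v, u} G) : GRing S where
  R := S.X.sheaf
  act g U V h := ((S.ρ g).inv.appLE U V h).hom
  act_one U V hVU h a := by
    have key (f : S.X ⟶ S.X) (hf : f = 𝟙 _) (h : V ≤ f ⁻¹ᵁ U) :
        f.appLE U V h = S.X.presheaf.map (homOfLE hVU).op := by
      subst hf
      simp [Scheme.Hom.appLE]
      rfl
    have h1 : (S.ρ 1).inv = 𝟙 _ := by rw [map_one]; rfl
    exact congrArg (fun f => f.hom a) (key _ h1 h)
  act_mul g h U V W h₁ h₂ h₃ a := by
    have key (f f₁ f₂ : S.X ⟶ S.X) (hf : f = f₁ ≫ f₂) (h₁ : V ≤ f₂ ⁻¹ᵁ U) (h₂ : W ≤ f₁ ⁻¹ᵁ V)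
        (h₃ : W ≤ f ⁻¹ᵁ U) : f.appLE U W h₃ = f₂.appLE U V h₁ ≫ f₁.appLE V W h₂ := by
      subst hf
      rw [Scheme.Hom.appLE_comp_appLE]
    have h1 : (S.ρ (g * h)).inv = (S.ρ g).inv ≫ (S.ρ h).inv := by rw [map_mul]; rfl
    exact congrArg (fun f => f.hom a) (key _ _ _ h1 h₁ h₂ h₃)

/-- The sheaf `W₂(𝒪_S) : U ↦ W₂(𝒪_S(U))`, with its induced action of `G`. -/
def wittSheaf (p : ℕ) [Fact p.Prime] (S : GScheme.{v, u} G) : GRing S where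
  R := ⟨S.X.presheaf ⋙ W₂functor p, W₂_isSheaf p S.X.presheaf S.X.sheaf.property⟩
  act g U V h := W₂map p ((structureSheaf S).act g U V h)
  act_one U V hVU h a := by
    refine TruncatedWittVector.ext (p := p) fun i => ?_
    refine (W₂map_coeff p _ _ i).trans (Eq.trans ?_ (W₂map_coeff p _ _ i).symm)
    exact (structureSheaf S).act_one U V hVU h _
  act_mul g h U V W h₁ h₂ h₃ a := by
    refine TruncatedWittVector.ext (p := p) fun i => ?_
    refine (W₂map_coeff p _ _ i).trans (Eq.trans ?_ (W₂map_coeff p _ _ i).symm)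
    refine Eq.trans ?_ (congrArg _ (W₂map_coeff p _ _ i).symm)
    exact (structureSheaf S).act_mul g h U V W h₁ h₂ h₃ _

/-- The reduction `W₂(𝒪_S(U)) → 𝒪_S(U)`, on sections over `U`. -/
def wittRed (p : ℕ) [Fact p.Prime] (S : GScheme.{v, u} G) (U : S.X.Opens) :
    (wittSheaf p S).sec U →+* (structureSheaf S).sec U :=
  W₂red p Γ(S.X, U)

/-! ### Modules with a semilinear action of `G` -/

variable {S : GScheme.{v, u} G}

/-- The sheaf of rings underlying `𝓡`, in the form used for sheaves of modules. -/
abbrev GRing.ringSheaf (𝓡 : GRing S) : TopCat.Sheaf RingCat.{u} S.X :=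
  (sheafCompose _ (forget₂ CommRingCat RingCat.{u})).obj 𝓡.R

/-- Sections of a sheaf of modules over an open. -/
abbrev msec {𝓡 : GRing S} (M : SheafOfModules.{u} 𝓡.ringSheaf) (U : S.X.Opens) : Type u :=
  M.val.obj (op U)

instance {𝓡 : GRing S} (M : SheafOfModules.{u} 𝓡.ringSheaf) (U : S.X.Opens) :
    Module (𝓡.sec U) (msec M U) :=
  (M.val.obj (op U)).isModule

/-- Restriction of sections of a sheaf of modules. -/
def res {𝓡 : GRing S} (M : SheafOfModules.{u} 𝓡.ringSheaf) {U V : S.X.Opens} (h : V ≤ U) :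
    msec M U →+ msec M V :=
  (M.val.presheaf.map (homOfLE h).op).hom

/-- A morphism of sheaves of modules, on sections over `U`. -/
def mapp {𝓡 : GRing S} {M N : SheafOfModules.{u} 𝓡.ringSheaf} (f : M ⟶ N) (U : S.X.Opens) :
    msec M U →ₗ[𝓡.sec U] msec N U :=
  (f.val.app (op U)).hom

/-- A sheaf of `𝓡`-modules with a naive semilinear action of `G`, recorded, as for sheaves of
rings, through the maps `M(U) → M(gU) → M(V)`, for all opens `V ⊆ gU`. -/
structure GModule (𝓡 : GRing S) where
  /-- the sheaf of modules -/
  M : SheafOfModules.{u} 𝓡.ringSheaf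
  /-- the action of `G` -/
  act (g : G) (U V : S.X.Opens) (h : V ≤ S.translate g U) :
    msec M U →ₛₗ[𝓡.act g U V h] msec M V
  act_one (U V : S.X.Opens) (hVU : V ≤ U) (h : V ≤ S.translate 1 U) (x : msec M U) :
    act 1 U V h x = res M hVU x
  act_mul (g h : G) (U V W : S.X.Opens) (h₁ : V ≤ S.translate h U) (h₂ : W ≤ S.translate g V)
    (h₃ : W ≤ S.translate (g * h) U) (x : msec M U) :
    act (g * h) U W h₃ x = act g V W h₂ (act h U V h₁ x)
  naive : ∃ N : OpenSubgroup G, ∀ g ∈ N, ∀ (U V : S.X.Opens) (hVU : V ≤ U)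
    (h : V ≤ S.translate g U) (x : msec M U), act g U V h x = res M hVU x

/-- A sheaf of modules is locally free of rank `n` if every point has an open neighbourhood `U`
over which there are sections `e₁, …, eₙ` that identify `𝓡ⁿ` with `M` over `U`. -/
def GModule.IsLocallyFreeOfRank {𝓡 : GRing S} (M : GModule 𝓡) (n : ℕ) : Prop :=
  ∀ x : S.X, ∃ U : S.X.Opens, x ∈ U ∧ ∃ e : Fin n → msec M.M U,
    ∀ (V : S.X.Opens) (hVU : V ≤ U),
      Function.Bijective (fun a : Fin n → 𝓡.sec V => ∑ i, a i • res M.M hVU (e i))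

/-- A vector bundle: locally free of finite constant rank. -/
def GModule.IsVectorBundle {𝓡 : GRing S} (M : GModule 𝓡) : Prop :=
  ∃ n : ℕ, M.IsLocallyFreeOfRank n

/-- A line bundle: locally free of rank one. -/
def GModule.IsLineBundle {𝓡 : GRing S} (M : GModule 𝓡) : Prop :=
  M.IsLocallyFreeOfRank 1

/-- The action of `G` on `𝓡` as a module over itself is semilinear. -/
def unitAct (𝓡 : GRing S) (g : G) (U V : S.X.Opens) (h : V ≤ S.translate g U) :
    msec (SheafOfModules.unit 𝓡.ringSheaf) U →ₛₗ[𝓡.act g U V h]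
      msec (SheafOfModules.unit 𝓡.ringSheaf) V where
  toFun x := 𝓡.act g U V h x
  map_add' x y := map_add (𝓡.act g U V h) x y
  map_smul' a x := map_mul (𝓡.act g U V h) a x

/-- A morphism between the sheaves underlying two modules with `G`-action is `G`-equivariant. -/
def IsEquivariant {𝓡 : GRing S} {M N : SheafOfModules.{u} 𝓡.ringSheaf}
    (actM : ∀ (g : G) (U V : S.X.Opens) (h : V ≤ S.translate g U),
      msec M U →ₛₗ[𝓡.act g U V h] msec M V)
    (actN : ∀ (g : G) (U V : S.X.Opens) (h : V ≤ S.translate g U),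
      msec N U →ₛₗ[𝓡.act g U V h] msec N V) (f : M ⟶ N) : Prop :=
  ∀ (g : G) (U V : S.X.Opens) (h : V ≤ S.translate g U) (x : msec M U),
    mapp f V (actM g U V h x) = actN g U V h (mapp f U x)

/-- An extension `0 → L → E → 𝓡 → 0` of sheaves of `𝓡`-modules with `G`-action. -/
structure GExtension {𝓡 : GRing S} (L : GModule 𝓡) where
  /-- the middle term -/
  E : GModule 𝓡
  /-- the injection -/
  ι : L.M ⟶ E.M
  /-- the surjection -/
  q : E.M ⟶ SheafOfModules.unit 𝓡.ringSheaf
  ι_equivariant : IsEquivariant L.act E.act ι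
  q_equivariant : IsEquivariant E.act (unitAct 𝓡) q
  zero : ι ≫ q = 0
  exact : (ShortComplex.mk ι q zero).ShortExact

/-- The extension is geometrically split: `E → 𝓡` has an `𝓡`-linear section, which need not be
`G`-equivariant. -/
def GExtension.IsGeometricallySplit {𝓡 : GRing S} {L : GModule 𝓡} (𝓔 : GExtension L) : Prop :=
  ∃ s : SheafOfModules.unit 𝓡.ringSheaf ⟶ 𝓔.E.M, s ≫ 𝓔.q = 𝟙 _

/-- A `G`-equivariant morphism `M₂ → M₁` from a `W₂(𝒪_S)`-module to an `𝒪_S`-module, linear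
with respect to the reduction `W₂(𝒪_S) → 𝒪_S`. -/
structure RedHom (p : ℕ) [Fact p.Prime] (M₂ : GModule (wittSheaf p S))
    (M₁ : GModule (structureSheaf S)) where
  /-- the map on sections over an open -/
  app (U : S.X.Opens) : msec M₂.M U →ₛₗ[wittRed p S U] msec M₁.M U
  app_res (U V : S.X.Opens) (h : V ≤ U) (x : msec M₂.M U) :
    app V (res M₂.M h x) = res M₁.M h (app U x)
  app_act (g : G) (U V : S.X.Opens) (h : V ≤ S.translate g U) (x : msec M₂.M U) :
    app V (M₂.act g U V h x) = M₁.act g U V h (app U x)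

/-- The morphism `M₂ → M₁` makes the bundle `M₂` a lift of the bundle `M₁`, i.e. induces an
isomorphism from the reduction of `M₂` (the sheaf associated with the presheaf
`U ↦ 𝒪_S(U) ⊗ M₂(U)`, the tensor product being over `W₂(𝒪_S(U))`) to `M₁`. For bundles, this
means that `𝒪_S(V) ⊗ M₂(V) → M₁(V)` is an isomorphism for all sufficiently small opens `V`. -/
def RedHom.IsLift {p : ℕ} [Fact p.Prime] {M₂ : GModule (wittSheaf p S)}
    {M₁ : GModule (structureSheaf S)} (r : RedHom p M₂ M₁) : Prop :=
  ∀ x : S.X, ∃ U : S.X.Opens, x ∈ U ∧ ∀ V : S.X.Opens, V ≤ U →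
    IsScalarExtension (wittRed p S V) (r.app V)

end Schemes

end GWitt

end

/-! A section s of E₁ → 𝒪_S turns 𝓔₁ into the cocycle c(g) = g·s(1) - s(1) with values in Γ(S, L₁).
Conversely, a lift L₂ of L₁ together with a cocycle w in Γ(S, L₂) lifting c gives the extension L₂ ×
W₂(𝒪_S) with action g(x, a) = (gx + ga·w(g), ga), which lifts 𝓔₁. So the pair (L₁, c) has to be
lifted. The difficulty is that (1,1)-smoothness speaks only of modules over rings, while S need not
be affine.

The bridge is the perfect ring A = ⊕ Γ(S, L₁^q), with q in ℕ[1/p]; fractional powers of L₁ make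
sense because S is perfect. It contains Γ(S, L₁) as its part of degree one, so c is a cocycle in A.
Smoothness is applied to A, the trivial line bundle A and the class of c. The resulting lift is free
over W₂(A), because W₂(A) → A has square-zero kernel (`bijective_smul_of_lift`). In a basis it
amounts to functions u, w : G → W₂(A), where u reduces to 1, w reduces to c, u(gh) = u(g)·g(u(h))
and w(gh) = w(g) + u(g)·g(w(h)) (`IsOneOneSmooth.exists_twist`).

To return to S, one keeps the degree zero part of u and the degree one part of w. In W₂ the elements
of degree one are (at, bt^p) = [t]·(a, b), so under a change of generator by r the degree one part
is multiplied by [r]: it is a section of the Teichmüller lift of L₁. The projection to degree one is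
not additive on W₂(A), since carries mix degrees. It nevertheless respects the relation between u
and w, because the first component of w(g) is purely of degree one (`ExpPoly.degreeOne_cocycle`).
The lift L₂ is the Teichmüller lift of L₁ with its action multiplied by the degree zero part of u.

A section of L₁^q is encoded as a function of the local generators of L₁ that is multiplied by r^q
under a change of generator. Both A (`homogeneousRing`) and the Teichmüller lift (`wittFamily`)
consist of such families, so no tensor powers and no glued bundles have to be constructed. -/

noncomputable section

namespace GWitt

/-! ### Arithmetic of Witt vectors of length two in characteristic `p` -/

namespace W₂

variable {p : ℕ} [Fact p.Prime] {A : Type u} [CommRing A]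

theorem ext' {x y : W₂ p A} (h0 : W₂red p A x = W₂red p A y) (h1 : x.coeff 1 = y.coeff 1) :
    x = y := by
  refine TruncatedWittVector.ext (p := p) fun i => ?_
  fin_cases i
  · exact h0
  · exact h1

theorem red_truncate (x : WittVector p A) :
    W₂red p A (WittVector.truncate 2 x : W₂ p A) = WittVector.coeff x 0 :=
  WittVector.coeff_truncate x 0

theorem coeff_truncate (x : WittVector p A) :
    TruncatedWittVector.coeff 1 (WittVector.truncate 2 x : W₂ p A) = WittVector.coeff x 1 :=
  WittVector.coeff_truncate x 1

/-- The Verschiebung `A → W₂(A)`, `a ↦ (0, a)`. -/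
def ver (p : ℕ) [Fact p.Prime] {A : Type u} [CommRing A] : A →+ W₂ p A where
  toFun a := WittVector.truncate 2 (WittVector.verschiebung (WittVector.teichmuller p a))
  map_zero' := by simp
  map_add' a b := by
    rw [← map_add, ← map_add]
    refine ext' ?_ ?_
    · rw [red_truncate, red_truncate]
      rw [WittVector.verschiebung_coeff_zero, WittVector.verschiebung_coeff_zero]
    · rw [coeff_truncate, coeff_truncate]
      rw [show (1 : ℕ) = 0 + 1 from rfl, WittVector.verschiebung_coeff_add_one,
        WittVector.verschiebung_coeff_add_one, WittVector.add_coeff_zero]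
      simp

theorem ver_def (a : A) : ver p a =
    (WittVector.truncate 2 (WittVector.verschiebung (WittVector.teichmuller p a)) : W₂ p A) := rfl

theorem red_ver (a : A) : W₂red p A (ver p a) = 0 :=
  (red_truncate _).trans (WittVector.verschiebung_coeff_zero _)

theorem coeff_ver (a : A) : (ver p a).coeff 1 = a :=
  (coeff_truncate _).trans <|
    (WittVector.verschiebung_coeff_add_one _ 0).trans (WittVector.teichmuller_coeff_zero _ _)

theorem ver_injective : Function.Injective (ver p : A →+ W₂ p A) := fun a b h => by
  rw [← coeff_ver (p := p) a, h, coeff_ver]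

/-- The Teichmüller representative `a ↦ (a, 0)`. -/
def teich (p : ℕ) [Fact p.Prime] {A : Type u} [CommRing A] : A →* W₂ p A :=
  (WittVector.truncate 2 : WittVector p A →+* _).toMonoidHom.comp (WittVector.teichmuller p)

theorem teich_def (a : A) :
    teich p a = (WittVector.truncate 2 (WittVector.teichmuller p a) : W₂ p A) := rfl

theorem red_teich (a : A) : W₂red p A (teich p a) = a :=
  (red_truncate _).trans (WittVector.teichmuller_coeff_zero _ _)

theorem coeff_teich (a : A) : (teich p a).coeff 1 = 0 :=
  (coeff_truncate _).trans (WittVector.teichmuller_coeff_pos p _ _ one_pos)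

/-- The projection formula V(x)·y = V(x·F(y)), where in characteristic p the Frobenius F raises
components to the p-th power. -/
theorem ver_mul (hp : (p : A) = 0) (a : A) (y : W₂ p A) :
    ver p a * y = ver p (a * W₂red p A y ^ p) := by
  -- The zero ring is set apart because it does not satisfy `CharP A p`.
  rcases subsingleton_or_nontrivial A with _ | _
  · refine ext' (Subsingleton.elim _ _) (Subsingleton.elim _ _)
  have : CharP A p := (CharP.charP_iff_prime_eq_zero Fact.out).2 hp
  obtain ⟨y, rfl⟩ := WittVector.truncate_surjective p 2 A y
  refine ext' (by rw [map_mul, red_ver, red_ver, zero_mul]) ?_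
  rw [coeff_ver, red_truncate, ver_def, ← map_mul, coeff_truncate,
    ← WittVector.verschiebung_mul_frobenius, show (1 : ℕ) = 0 + 1 from rfl,
    WittVector.verschiebung_coeff_add_one, WittVector.mul_coeff_zero,
    WittVector.coeff_frobenius_charP, WittVector.teichmuller_coeff_zero]

theorem mul_ver (hp : (p : A) = 0) (a : A) (y : W₂ p A) :
    y * ver p a = ver p (W₂red p A y ^ p * a) := by
  rw [mul_comm, ver_mul hp, mul_comm]

/-- A Witt vector with vanishing first component is in the image of the Verschiebung. -/
theorem eq_ver {x : W₂ p A} (h : W₂red p A x = 0) : x = ver p (x.coeff 1) :=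
  ext' (h.trans (red_ver _).symm) (coeff_ver _).symm

/-- By the projection formula V(a)·V(b) = V(a·0^p). That the kernel of the reduction has square zero
is what lets generators lift in `bijective_smul_of_lift`. -/
theorem mul_eq_zero_of_red (hp : (p : A) = 0) {x y : W₂ p A} (hx : W₂red p A x = 0)
    (hy : W₂red p A y = 0) : x * y = 0 := by
  rw [eq_ver hx, ver_mul hp, hy, zero_pow (Fact.out : p.Prime).ne_zero, mul_zero, map_zero]

theorem eq_teich_add_ver_coeff_sub (x : W₂ p A) :
    x = teich p (W₂red p A x) + ver p ((x - teich p (W₂red p A x)).coeff 1) := by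
  rw [← eq_ver (by rw [map_sub, red_teich, sub_self]), add_sub_cancel]

/-- The carry of Witt addition vanishes when one of the first components does. The proof writes x as
[x₀] + V(y) and uses that [x₀] and V(y + b) have disjoint supports, so that they are added
componentwise. -/
theorem coeff_add_ver (x : W₂ p A) (b : A) :
    (x + ver p b).coeff 1 = x.coeff 1 + b := by
  have h : ∀ y : A, (teich p (W₂red p A x) + ver p y).coeff 1 = y := by
    intro y
    rw [teich_def, ver_def, ← map_add, coeff_truncate]
    rw [WittVector.coeff_add_of_disjoint]
    · rw [WittVector.teichmuller_coeff_pos p _ _ one_pos, zero_add]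
      exact WittVector.verschiebung_coeff_add_one _ 0
    · intro n
      rcases n with _ | n
      · right; exact WittVector.verschiebung_coeff_zero _
      · left; exact WittVector.teichmuller_coeff_pos p _ _ n.succ_pos
  have h' := congrArg (TruncatedWittVector.coeff (1 : Fin 2)) (eq_teich_add_ver_coeff_sub x)
  rw [h] at h'
  rw [h', ← h (_ + b), map_add, ← add_assoc, ← eq_teich_add_ver_coeff_sub x]

theorem eq_teich_add_ver (x : W₂ p A) :
    x = teich p (W₂red p A x) + ver p (x.coeff 1) :=
  ext' (by rw [map_add, red_teich, red_ver, add_zero])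
    (by rw [coeff_add_ver, coeff_teich, zero_add])

theorem coeff_teich_mul (hp : (p : A) = 0) (a : A) (x : W₂ p A) :
    (teich p a * x).coeff 1 = a ^ p * x.coeff 1 := by
  rw [eq_teich_add_ver x, mul_add, ← map_mul, mul_ver hp, coeff_add_ver, coeff_add_ver,
    coeff_teich, coeff_teich, zero_add, zero_add, red_teich]

theorem red_teich_mul (a : A) (x : W₂ p A) :
    W₂red p A (teich p a * x) = a * W₂red p A x := by
  rw [map_mul, red_teich]

variable {B : Type u} [CommRing B] (f : A →+* B)

theorem red_map (x : W₂ p A) : W₂red p B (W₂map p f x) = f (W₂red p A x) := W₂map_coeff p f x 0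

theorem coeff_map (x : W₂ p A) : (W₂map p f x).coeff 1 = f (x.coeff 1) := W₂map_coeff p f x 1

theorem map_teich (a : A) : W₂map p f (teich p a) = teich p (f a) :=
  ext' (by rw [red_map, red_teich, red_teich])
    (by rw [coeff_map, coeff_teich, coeff_teich, map_zero])

theorem map_ver (a : A) : W₂map p f (ver p a) = ver p (f a) :=
  ext' (by rw [red_map, red_ver, red_ver, map_zero])
    (by rw [coeff_map, coeff_ver, coeff_ver])

theorem map_map {C : Type u} [CommRing C] (g : B →+* C) (x : W₂ p A) :
    W₂map p g (W₂map p f x) = W₂map p (g.comp f) x :=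
  ext' (by simp only [red_map]; rfl) (by simp only [coeff_map]; rfl)

theorem map_id (x : W₂ p A) : W₂map p (RingHom.id A) x = x :=
  ext' (by simp only [red_map]; rfl) (by simp only [coeff_map]; rfl)

theorem red_surjective : Function.Surjective (W₂red p A) := fun a => ⟨teich p a, red_teich a⟩

end W₂

/-! ### Scalar extensions along surjections, and between free modules -/

open TensorProduct in
-- When R → R' is onto, every element of R' ⊗ M has the form 1 ⊗ m.
theorem _root_.IsBaseChange.surjective_of_surjective {R R' M N : Type*} [CommRing R] [CommRing R']
    [Algebra R R'] [AddCommGroup M] [Module R M] [AddCommGroup N] [Module R N] [Module R' N]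
    [IsScalarTower R R' N] {f : M →ₗ[R] N} (hf : IsBaseChange R' f)
    (hR : Function.Surjective (algebraMap R R')) : Function.Surjective f := by
  have key : ∀ t : R' ⊗[R] M, ∃ m : M, t = 1 ⊗ₜ[R] m := by
    intro t
    induction t with
    | zero => exact ⟨0, (tmul_zero _ _).symm⟩
    | tmul r m =>
      obtain ⟨r, rfl⟩ := hR r
      exact ⟨r • m, by rw [← smul_tmul, Algebra.algebraMap_eq_smul_one]⟩
    | add x y hx hy =>
      obtain ⟨m, rfl⟩ := hx
      obtain ⟨n, rfl⟩ := hy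
      exact ⟨m + n, (tmul_add _ _ _).symm⟩
  intro n
  obtain ⟨m, hm⟩ := key (hf.equiv.symm n)
  refine ⟨m, ?_⟩
  have := congrArg hf.equiv hm
  rw [LinearEquiv.apply_symm_apply, hf.equiv_tmul, one_smul] at this
  exact this.symm

open TensorProduct in
-- Right exactness of the tensor product, applied to I → R → R' → 0, identifies the kernel of M → R'
-- ⊗ M with I·M.
theorem _root_.IsBaseChange.mem_ker_smul_top {R R' M N : Type*} [CommRing R] [CommRing R']
    [Algebra R R'] [AddCommGroup M] [Module R M] [AddCommGroup N] [Module R N] [Module R' N]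
    [IsScalarTower R R' N] {f : M →ₗ[R] N} (hf : IsBaseChange R' f)
    (hR : Function.Surjective (algebraMap R R')) {m : M} (hm : f m = 0) :
    m ∈ RingHom.ker (algebraMap R R') • (⊤ : Submodule R M) := by
  have h1 : (1 : R') ⊗ₜ[R] m = 0 := by
    apply hf.equiv.injective
    rw [hf.equiv_tmul, one_smul, hm, map_zero]
  have hex : Function.Exact (RingHom.ker (algebraMap R R')).subtype
      (Algebra.linearMap R R') := by
    intro x
    simp [RingHom.mem_ker]
  have h2 := ((rTensor_exact M hex hR) (1 ⊗ₜ m)).1 (by simpa using h1)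
  obtain ⟨t, ht⟩ := h2
  have h3 : ∀ t : RingHom.ker (algebraMap R R') ⊗[R] M,
      TensorProduct.lid R M ((RingHom.ker (algebraMap R R')).subtype.rTensor M t) ∈
        RingHom.ker (algebraMap R R') • (⊤ : Submodule R M) := by
    intro t
    induction t with
    | zero => simp
    | tmul r m =>
      simpa using Submodule.smul_mem_smul r.2 (Submodule.mem_top (x := m))
    | add x y hx hy => rw [map_add, map_add]; exact add_mem hx hy
  have h4 := h3 t
  rwa [ht, lid_tmul, one_smul] at h4

section

variable {R R' : Type*} [CommRing R] [CommRing R'] {φ : R →+* R'}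
    {M N : Type*} [AddCommGroup M] [Module R M] [AddCommGroup N] [Module R' N] {π : M →ₛₗ[φ] N}

theorem IsScalarExtension.surjective (h : IsScalarExtension φ π) (hφ : Function.Surjective φ) :
    Function.Surjective π :=
  letI : Algebra R R' := φ.toAlgebra
  letI : Module R N := Module.compHom N φ
  haveI : IsScalarTower R R' N := ⟨fun r r' x => mul_smul (φ r) r' x⟩
  IsBaseChange.surjective_of_surjective h hφ

theorem IsScalarExtension.mem_ker_smul_top (h : IsScalarExtension φ π)
    (hφ : Function.Surjective φ) {m : M} (hm : π m = 0) :
    m ∈ RingHom.ker φ • (⊤ : Submodule R M) :=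
  letI : Algebra R R' := φ.toAlgebra
  letI : Module R N := Module.compHom N φ
  haveI : IsScalarTower R R' N := ⟨fun r r' x => mul_smul (φ r) r' x⟩
  IsBaseChange.mem_ker_smul_top h hφ hm

/-- A semilinear map of free modules which sends a basis to a basis is a scalar extension. -/
theorem isScalarExtension_of_bijective {n : ℕ} (e : Fin n → M)
    (he : Function.Bijective fun a : Fin n → R => ∑ i, a i • e i)
    (hπ : Function.Bijective fun a : Fin n → R' => ∑ i, a i • π (e i)) :
    IsScalarExtension φ π := by
  let : Algebra R R' := φ.toAlgebra
  let : Module R N := Module.compHom N φ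
  have : IsScalarTower R R' N := ⟨fun r r' x => mul_smul (φ r) r' x⟩
  have he' : Function.Bijective (Fintype.linearCombination R e) := he
  have hπ' : Function.Bijective (Fintype.linearCombination R' fun i => π (e i)) := hπ
  let b : Module.Basis (Fin n) R M := Module.Basis.ofEquivFun
    (LinearEquiv.ofBijective (Fintype.linearCombination R e) he').symm
  let b' : Module.Basis (Fin n) R' N := Module.Basis.ofEquivFun
    (LinearEquiv.ofBijective (Fintype.linearCombination R' fun i => π (e i)) hπ').symm
  have hb (i) : b i = e i := by
    simp only [b, Module.Basis.coe_ofEquivFun, LinearEquiv.symm_symm]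
    simp [LinearEquiv.ofBijective_apply, Fintype.linearCombination_apply_single]
  have hb' (i) : b' i = π (e i) := by
    simp only [b', Module.Basis.coe_ofEquivFun, LinearEquiv.symm_symm]
    simp [LinearEquiv.ofBijective_apply, Fintype.linearCombination_apply_single]
  let f : M →ₗ[R] N := { toFun := π, map_add' := map_add π, map_smul' := map_smulₛₗ π }
  change IsBaseChange R' f
  let E := (Algebra.TensorProduct.basis R' b).equiv b' (Equiv.refl _)
  have hE : E.toLinearMap.restrictScalars R ∘ₗ TensorProduct.mk R R' M 1 = f := by
    refine b.ext fun i => ?_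
    have h1 := (Algebra.TensorProduct.basis R' b).equiv_apply i b' (Equiv.refl _)
    rw [Algebra.TensorProduct.basis_apply] at h1
    refine h1.trans ?_
    rw [hb]
    exact hb' i
  exact IsBaseChange.of_equiv E fun x => LinearMap.congr_fun hE x

end

/-! ### The cocycles provided by `(1,1)`-smoothness -/

section Smooth

variable {G : Type v} [Group G] [TopologicalSpace G]

theorem IsNaive.isLocallyConstant_smul [IsTopologicalGroup G] {X : Type*} [MulAction G X]
    (hX : IsNaive G X) (x : X) : IsLocallyConstant fun g : G => g • x := by
  obtain ⟨N, hN⟩ := hX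
  refine (IsLocallyConstant.iff_exists_open _).2 fun g => ⟨(fun h => g⁻¹ * h) ⁻¹' N,
    N.isOpen.preimage (continuous_const_mul _), by simp [one_mem], fun h hh => ?_⟩
  have := hN _ hh x
  rw [mul_smul, inv_smul_eq_iff] at this
  exact this

/-- A locally constant cocycle which vanishes on a neighbourhood of the identity. -/
theorem exists_openSubgroup_of_isLocallyConstant {M : Type*} [AddCommGroup M]
    [DistribMulAction G M] (hM : IsNaive G M) {z : G → M} (hz : z ∈ Z1 G M) :
    ∃ N : OpenSubgroup G, (∀ g ∈ N, z g = 0) ∧ ∀ g ∈ N, ∀ x : M, g • x = x := by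
  obtain ⟨N, hN⟩ := hM
  have h1 : z 1 = 0 := by
    have := hz.2 1 1
    rwa [one_smul, mul_one, left_eq_add] at this
  let H : Subgroup G :=
    { carrier := {g | g ∈ N ∧ z g = 0}
      one_mem' := ⟨one_mem N, h1⟩
      mul_mem' := fun {a b} ha hb =>
        ⟨mul_mem ha.1 hb.1, by rw [hz.2, ha.2, hb.2, smul_zero, add_zero]⟩
      inv_mem' := fun {a} ha => ⟨inv_mem ha.1, by
        have h2 := hz.2 a⁻¹ a
        rw [inv_mul_cancel, h1, ha.2, smul_zero, add_zero] at h2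
        exact h2.symm⟩ }
  have hH : IsOpen (H : Set G) := N.isOpen.inter (hz.1.isOpen_fiber 0)
  exact ⟨⟨H, hH⟩, fun g hg => hg.2, fun g hg => hN g hg.1⟩

/-- Let `π : L → A` be a lift of the trivial line bundle to an invertible `W₂(A)`-module. Every
preimage of `1` is a basis of `L`. -/
theorem bijective_smul_of_lift {p : ℕ} [Fact p.Prime] {A : Type u} [CommRing A]
    (hp : (p : A) = 0) {L : Type u} [AddCommGroup L] [Module (W₂ p A) L]
    [Module.Invertible (W₂ p A) L] {π : L →ₛₗ[W₂red p A] A}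
    (hπ : IsScalarExtension (W₂red p A) π) {x : L} (hx : π x = 1) :
    Function.Bijective fun a : W₂ p A => a • x := by
  set I : Ideal (W₂ p A) := RingHom.ker (W₂red p A)
  have hI : ∀ a ∈ I, ∀ b ∈ I, a * b = 0 := fun a ha b hb => W₂.mul_eq_zero_of_red hp ha hb
  -- Since x reduces to 1, it generates L modulo I·L.
  have key : ∀ y : L, ∃ a : W₂ p A, y - a • x ∈ I • (⊤ : Submodule (W₂ p A) L) := by
    intro y
    obtain ⟨a, ha⟩ := W₂.red_surjective (p := p) (π y)
    refine ⟨a, hπ.mem_ker_smul_top W₂.red_surjective ?_⟩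
    rw [map_sub, map_smulₛₗ, hx, ha, smul_eq_mul, mul_one, sub_self]
  -- If n = a•x modulo I·L and r is in I, then r•n = r•(a•x) because I² = 0. So the span of x
  -- already contains I·L.
  have key2 : ∀ y ∈ I • (⊤ : Submodule (W₂ p A) L), ∃ a : W₂ p A, a • x = y := by
    intro y hy
    induction hy using Submodule.smul_induction_on' with
    | smul r hr n _ =>
      obtain ⟨a, ha⟩ := key n
      refine ⟨r * a, ?_⟩
      have h0 : ∀ m ∈ I • (⊤ : Submodule (W₂ p A) L), r • m = 0 := by
        intro m hm
        induction hm using Submodule.smul_induction_on' with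
        | smul s hs k _ => rw [smul_smul, hI r hr s hs, zero_smul]
        | add k _ l _ hk hl => rw [smul_add, hk, hl, add_zero]
      have h1 := h0 _ ha
      rw [smul_sub, smul_smul] at h1
      exact (sub_eq_zero.1 h1).symm
    | add k _ l _ hk hl =>
      obtain ⟨a, rfl⟩ := hk
      obtain ⟨b, rfl⟩ := hl
      exact ⟨a + b, add_smul _ _ _⟩
  have hs : Function.Surjective (LinearMap.toSpanSingleton (W₂ p A) L x) := by
    intro y
    obtain ⟨a, ha⟩ := key y
    obtain ⟨b, hb⟩ := key2 _ ha
    refine ⟨b + a, ?_⟩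
    change (b + a) • x = y
    rw [add_smul, hb, sub_add_cancel]
  exact Module.Invertible.bijective_of_surjective hs

/-- Let `c` be a cocycle with values in a perfect ring `A` of characteristic `p`. If `G` is
`(1,1)`-smooth, then there are a twist `u` of the action of `G` on `W₂(A)` and a lift `w` of `c`
to a cocycle for the twisted action. -/
theorem IsOneOneSmooth.exists_twist [IsTopologicalGroup G] {p : ℕ} [Fact p.Prime] (hG : IsOneOneSmooth.{v, u} G p)
    {A : Type u} [CommRing A] (hp : (p : A) = 0) [MulSemiringAction G A]
    (hA : Function.Bijective fun a : A => a ^ p) (hGA : IsNaive G A)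
    {c : G → A} (hc : c ∈ Z1 G A) :
    ∃ u w : G → W₂ p A, (∀ g, W₂red p A (u g) = 1) ∧ (∀ g, W₂red p A (w g) = c g) ∧
      (∀ g h, u (g * h) = u g * W₂map p (MulSemiringAction.toRingHom G A g) (u h)) ∧
      (∀ g h, w (g * h) = w g + u g * W₂map p (MulSemiringAction.toRingHom G A g) (w h)) ∧
      ∃ N : OpenSubgroup G, ∀ g ∈ N, u g = 1 ∧ w g = 0 := by
  let _ : Algebra (ZMod p) A := by
    have := ringChar.charP A
    exact ZMod.algebra' A (ringChar A) (ringChar.dvd hp)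
  obtain ⟨L, _, _, _, π, hπG, _, hsemi, hLn, hπ, z, hz⟩ :=
    hG A hA hGA A (fun g a x => smul_mul' g a x) hGA (QuotientAddGroup.mk ⟨c, hc⟩)
  obtain ⟨x, hx⟩ := hπ.surjective W₂.red_surjective (1 : A)
  have hbij := bijective_smul_of_lift hp hπ hx
  obtain ⟨z, rfl⟩ := QuotientAddGroup.mk_surjective z
  obtain ⟨m, hm⟩ := (QuotientAddGroup.eq.1 hz : _)
  obtain ⟨m, rfl⟩ := hπ.surjective W₂.red_surjective m
  -- The class of z only has the same reduction as the class of c. Adding the coboundary of a lift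
  -- of m makes the reduction equal to c itself.
  let z' : G → L := fun g => z.1 g + (g • m - m)
  have hz' : z' ∈ Z1 G L :=
    add_mem z.2 ⟨(hLn.isLocallyConstant_smul m).sub (IsLocallyConstant.const m), fun g h => by
      simp only [smul_sub, mul_smul]; abel⟩
  have hzc : ∀ g, π (z' g) = c g := by
    intro g
    have h1 : -π (z.1 g) + c g = g • π m - π m := hm g
    rw [map_add, map_sub, hπG, ← h1, add_neg_cancel_left]
  -- Coordinates in the basis x: `u` is the matrix of the action and `w` the coordinate of the
  -- cocycle.
  choose u hu using fun g : G => hbij.2 (g • x)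
  choose w hw using fun g : G => hbij.2 (z' g)
  simp only at hu hw
  refine ⟨u, w, fun g => ?_, fun g => ?_, fun g h => hbij.1 ?_, fun g h => hbij.1 ?_, ?_⟩
  · have := congrArg π (hu g)
    rwa [map_smulₛₗ, hπG, hx, smul_one, smul_eq_mul, mul_one] at this
  · have := congrArg π (hw g)
    rwa [map_smulₛₗ, hzc, hx, smul_eq_mul, mul_one] at this
  · change u (g * h) • x = (_ * _) • x
    rw [hu, mul_smul, ← hu h, hsemi, ← hu g, smul_smul, mul_comm]
  · change w (g * h) • x = (_ + _ * _) • x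
    rw [hw, hz'.2, add_smul, hw, ← hw h, hsemi, ← hu g, smul_smul, mul_comm]
  · obtain ⟨N, hN, hN'⟩ := exists_openSubgroup_of_isLocallyConstant hLn hz'
    refine ⟨N, fun g hg => ⟨hbij.1 ?_, hbij.1 ?_⟩⟩
    · change u g • x = (1 : W₂ p A) • x
      rw [hu, hN' g hg, one_smul]
    · change w g • x = (0 : W₂ p A) • x
      rw [hw, hN g hg, zero_smul]

end Smooth

/-! ### Polynomials with exponents in `ℕ[1/p]` -/

section Exponents

/-- The monoid `ℕ[1/p]`. -/
def Exps (p : ℕ) : AddSubmonoid ℚ≥0 where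
  carrier := {q | ∃ k a : ℕ, q * (p : ℚ≥0) ^ k = a}
  zero_mem' := ⟨0, 0, by simp⟩
  add_mem' := by
    rintro x y ⟨k, a, h⟩ ⟨l, b, h'⟩
    refine ⟨k + l, a * p ^ l + b * p ^ k, ?_⟩
    push_cast
    rw [← h, ← h']
    ring

variable {p : ℕ}

/-- The exponent `n`. -/
def Exps.nat (p n : ℕ) : Exps p := ⟨n, 0, n, by simp⟩

theorem Exps.nsmul_nat (n : ℕ) : n • Exps.nat p 1 = Exps.nat p n :=
  Subtype.ext (by simp [Exps.nat])

theorem Exps.add_eq_zero (q q' : Exps p) : q + q' = 0 ↔ q = 0 ∧ q' = 0 := by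
  simp only [Subtype.ext_iff, AddSubmonoid.coe_add, AddSubmonoid.coe_zero]
  exact _root_.add_eq_zero

theorem Exps.nsmul_bijective [hp : Fact p.Prime] : Function.Bijective fun q : Exps p => p • q := by
  have hp0 : (p : ℚ≥0) ≠ 0 := Nat.cast_ne_zero.2 hp.out.ne_zero
  constructor
  · intro q r h
    refine Subtype.ext (mul_left_cancel₀ hp0 ?_)
    simpa using congrArg Subtype.val h
  · rintro ⟨q, k, a, h⟩
    refine ⟨⟨q / p, k + 1, a, ?_⟩, Subtype.ext ?_⟩
    · rw [← h, pow_succ]; field_simp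
    · change p • (q / p) = q
      rw [nsmul_eq_mul]
      field_simp

theorem pow_pow_bijective {R : Type*} [CommRing R] (hR : Function.Bijective fun a : R => a ^ p)
    (k : ℕ) : Function.Bijective fun a : R => a ^ p ^ k := by
  have : (fun a : R => a ^ p ^ k) = (fun a : R => a ^ p)^[k] := by
    ext a
    rw [pow_iterate]
  rw [this]
  exact hR.iterate k

/-! ### Powers with exponents in ℕ[1/p] in a perfect ring. -/

section Power

variable {R : Type*} [CommRing R] (hR : Function.Bijective fun a : R => a ^ p)
include hR

/-- For q = a / p^k the power is the p^k-th root of r^a. Asking for this with all presentations of q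
at once makes the power independent of any choice; one presentation implies the others because
p-power maps are injective. -/
theorem existsUnique_expPow (r : R) (q : Exps p) :
    ∃! s : R, ∀ k a : ℕ, (q : ℚ≥0) * (p : ℚ≥0) ^ k = a → s ^ p ^ k = r ^ a := by
  obtain ⟨q, k, a, h⟩ := q
  obtain ⟨s, hs⟩ := (pow_pow_bijective hR k).2 (r ^ a)
  simp only at hs
  refine ⟨s, fun l b hl => (pow_pow_bijective hR k).1 ?_,
    fun t ht => (pow_pow_bijective hR k).1 ((ht k a h).trans hs.symm)⟩
  have hab : b * p ^ k = a * p ^ l := by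
    have : ((b * p ^ k : ℕ) : ℚ≥0) = (a * p ^ l : ℕ) := by
      push_cast
      rw [← h, ← hl]
      ring
    exact_mod_cast this
  simp only
  rw [← pow_mul, mul_comm, pow_mul, hs, ← pow_mul, ← pow_mul, hab]

/-- In a perfect ring, the power of an element by an exponent in `ℕ[1/p]`. -/
def expPow (r : R) (q : Exps p) : R := (existsUnique_expPow hR r q).choose

theorem expPow_pow (r : R) (q : Exps p) {k a : ℕ} (h : (q : ℚ≥0) * (p : ℚ≥0) ^ k = a) :
    expPow hR r q ^ p ^ k = r ^ a :=
  (existsUnique_expPow hR r q).choose_spec.1 k a h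

/-- A single presentation of q determines the power; the rules for powers below are all obtained in
this way. -/
theorem eq_expPow {r s : R} {q : Exps p} {k a : ℕ} (h : (q : ℚ≥0) * (p : ℚ≥0) ^ k = a)
    (hs : s ^ p ^ k = r ^ a) : s = expPow hR r q :=
  (pow_pow_bijective hR k).1 (hs.trans (expPow_pow hR r q h).symm)

theorem expPow_nat (r : R) (n : ℕ) : expPow hR r (Exps.nat p n) = r ^ n :=
  (eq_expPow hR (k := 0) (a := n) (by simp [Exps.nat]) (by simp)).symm

theorem expPow_zero (r : R) : expPow hR r 0 = 1 :=
  (eq_expPow hR (k := 0) (a := 0) (by simp) (by simp)).symm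

theorem expPow_add (r : R) (q q' : Exps p) :
    expPow hR r (q + q') = expPow hR r q * expPow hR r q' := by
  obtain ⟨k, a, h⟩ := q.2
  obtain ⟨l, b, h'⟩ := q'.2
  refine (eq_expPow hR (k := k + l) (a := a * p ^ l + b * p ^ k) ?_ ?_).symm
  · push_cast
    rw [← h, ← h']
    ring
  · rw [mul_pow, pow_add p, pow_mul, expPow_pow hR r q h, mul_comm (p ^ k), pow_mul,
      expPow_pow hR r q' h', ← pow_mul, ← pow_mul, ← pow_add]

theorem map_expPow {R' : Type*} [CommRing R'] (hR' : Function.Bijective fun a : R' => a ^ p)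
    (f : R →+* R') (r : R) (q : Exps p) : f (expPow hR r q) = expPow hR' (f r) q := by
  obtain ⟨k, a, h⟩ := q.2
  exact eq_expPow hR' h (by rw [← map_pow, expPow_pow hR r q h, map_pow])

end Power

/-- The ring of polynomials over `R` with exponents in `ℕ[1/p]`. -/
abbrev ExpPoly (p : ℕ) (R : Type u) [CommRing R] : Type u := AddMonoidAlgebra R (Exps p)

/-! ### The ring R[t^(1/p^∞)]: substitutions, constant term and perfectness. -/

namespace ExpPoly

variable {R : Type u} [CommRing R]

/-- The functoriality of `ExpPoly`. -/
def map (p : ℕ) {R' : Type u} [CommRing R'] (f : R →+* R') : ExpPoly p R →+* ExpPoly p R' :=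
  AddMonoidAlgebra.mapRingHom _ f

theorem coeff_map {R' : Type u} [CommRing R'] (f : R →+* R') (x : ExpPoly p R) (q : Exps p) :
    (map p f x).coeff q = f (x.coeff q) := by
  simp [map]

/-- The inclusion of the constants. -/
def ofConst (p : ℕ) (R : Type u) [CommRing R] : R →+* ExpPoly p R :=
  AddMonoidAlgebra.singleZeroRingHom

/-- The substitution of `r t` for the variable `t`. -/
def scale (hR : Function.Bijective fun a : R => a ^ p) (r : R) : ExpPoly p R →+* ExpPoly p R :=
  (AddMonoidAlgebra.lift R (ExpPoly p R) (Exps p)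
    { toFun := fun q => AddMonoidAlgebra.single q.toAdd (expPow hR r q.toAdd)
      map_one' := by rw [toAdd_one, expPow_zero]; rfl
      map_mul' := fun q q' => by
        rw [AddMonoidAlgebra.single_mul_single, toAdd_mul, expPow_add] }).toRingHom

theorem coeff_scale (hR : Function.Bijective fun a : R => a ^ p) (r : R) (x : ExpPoly p R)
    (q : Exps p) : (scale hR r x).coeff q = expPow hR r q * x.coeff q := by
  classical
  induction x using AddMonoidAlgebra.induction_linear with
  | zero => simp
  | add x y hx hy => simp [hx, hy, mul_add]
  | single m a =>
    have h : scale hR r (AddMonoidAlgebra.single m a) =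
        AddMonoidAlgebra.single m (a * expPow hR r m) := by
      simp [scale]
    rw [h]
    by_cases hm : m = q
    · subst hm
      simp [mul_comm]
    · simp [hm]

/-- The constant coefficient. -/
def const (p : ℕ) (R : Type u) [CommRing R] : ExpPoly p R →+* R :=
  open Classical in
  (AddMonoidAlgebra.lift R R (Exps p)
    { toFun := fun q => if q.toAdd = 0 then 1 else 0
      map_one' := by simp
      map_mul' := fun q q' => by
        -- Exponents are nonnegative, so a product of monomials is constant only if both factors
        -- are.
        simp only [toAdd_mul, Exps.add_eq_zero]
        split_ifs <;> simp_all }).toRingHom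

theorem const_apply (x : ExpPoly p R) : const p R x = x.coeff 0 := by
  classical
  induction x using AddMonoidAlgebra.induction_linear with
  | zero => simp
  | add x y hx hy => simp [hx, hy]
  | single m a => simp [const, AddMonoidAlgebra.coeff_single, Finsupp.single_apply]

theorem natCast_eq_zero (hp : (p : R) = 0) : (p : ExpPoly p R) = 0 := by
  rw [AddMonoidAlgebra.natCast_def, hp, AddMonoidAlgebra.single_zero]

theorem const_map {R' : Type u} [CommRing R'] (f : R →+* R') (x : ExpPoly p R) :
    const p R' (map p f x) = f (const p R x) := by
  rw [const_apply, const_apply, coeff_map]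

theorem const_scale (hR : Function.Bijective fun a : R => a ^ p) (r : R) (x : ExpPoly p R) :
    const p R (scale hR r x) = const p R x := by
  rw [const_apply, const_apply, coeff_scale, expPow_zero, one_mul]

theorem map_scale {R' : Type u} [CommRing R'] (hR : Function.Bijective fun a : R => a ^ p)
    (hR' : Function.Bijective fun a : R' => a ^ p) (f : R →+* R') (r : R) (x : ExpPoly p R) :
    map p f (scale hR r x) = scale hR' (f r) (map p f x) :=
  AddMonoidAlgebra.coeff_injective <| Finsupp.ext fun q => by
    rw [coeff_map, coeff_scale, coeff_scale, coeff_map, map_mul, map_expPow hR hR']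

/-- The monomial `a ↦ a t ^ n`. -/
def mono (p n : ℕ) : R →+ ExpPoly p R := AddMonoidAlgebra.singleAddHom (Exps.nat p n)

theorem mono_def (n : ℕ) (a : R) : mono p n a = AddMonoidAlgebra.single (Exps.nat p n) a := rfl

theorem coeff_mono (n : ℕ) (a : R) : (mono p n a).coeff (Exps.nat p n) = a := by
  simp [mono_def]

theorem map_mono {R' : Type u} [CommRing R'] (f : R →+* R') (n : ℕ) (a : R) :
    map p f (mono p n a) = mono p n (f a) := by
  simp [map, mono_def]

theorem scale_mono (hR : Function.Bijective fun a : R => a ^ p) (r : R) (n : ℕ) (a : R) :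
    scale hR r (mono p n a) = mono p n (r ^ n * a) := by
  rw [mono_def, mono_def, ← expPow_nat hR, mul_comm]
  simp [scale]

theorem mono_pow (n : ℕ) (a : R) : mono p 1 a ^ n = mono p n (a ^ n) := by
  rw [mono_def, AddMonoidAlgebra.single_pow, Exps.nsmul_nat, mono_def]

theorem mono_mul_ofConst (n : ℕ) (a b : R) :
    mono p n a * ofConst p R b = mono p n (a * b) := by
  simp [mono_def, ofConst]

theorem const_comp_ofConst : (const p R).comp (ofConst p R) = RingHom.id R :=
  RingHom.ext fun a => by simp [const_apply, ofConst]

/-- Only the constant term of x contributes to this coefficient. The case of constant term zero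
disposes of the error term in `degreeOne_cocycle`. -/
theorem coeff_mul_mono (x : ExpPoly p R) (n : ℕ) (a : R) :
    (x * mono p n a).coeff (Exps.nat p n) = const p R x * a := by
  have := AddMonoidAlgebra.coeff_mul_single_add x a (Exps.nat p n) 0
  rw [zero_add] at this
  rw [mono_def, this, const_apply]

variable [Fact p.Prime]

theorem _root_.add_pow_of_natCast_eq_zero {R : Type*} [CommRing R] (hp : (p : R) = 0) (x y : R) :
    (x + y) ^ p = x ^ p + y ^ p := by
  rcases subsingleton_or_nontrivial R with _ | _
  · exact Subsingleton.elim _ _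
  have : CharP R p := (CharP.charP_iff_prime_eq_zero Fact.out).2 hp
  exact add_pow_char x y p

/-- The p-th power map is additive, so it sends the sum of the a_q t^q to the sum of the a_q^p
t^(pq), and distinct exponents stay distinct. -/
theorem coeff_pow (hp : (p : R) = 0) (x : ExpPoly p R) (q : Exps p) :
    (x ^ p).coeff (p • q) = x.coeff q ^ p := by
  classical
  induction x using AddMonoidAlgebra.induction_linear with
  | zero => simp [(Fact.out : p.Prime).ne_zero]
  | add x y hx hy =>
    rw [add_pow_of_natCast_eq_zero (natCast_eq_zero hp), AddMonoidAlgebra.coeff_add,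
      AddMonoidAlgebra.coeff_add, Finsupp.add_apply, Finsupp.add_apply, hx, hy,
      add_pow_of_natCast_eq_zero hp]
  | single m a =>
    rw [AddMonoidAlgebra.single_pow]
    by_cases hm : m = q
    · subst hm
      simp
    · have : p • m ≠ p • q := fun h => hm (Exps.nsmul_bijective.1 h)
      simp [hm, this, (Fact.out : p.Prime).ne_zero]

/-- This is the reason for exponents in ℕ[1/p]: both the coefficients and the exponents have unique
p-th roots. -/
theorem pow_bijective (hp : (p : R) = 0) (hR : Function.Bijective fun a : R => a ^ p) :
    Function.Bijective fun x : ExpPoly p R => x ^ p := by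
  constructor
  · intro x y h
    refine AddMonoidAlgebra.coeff_injective (Finsupp.ext fun q => hR.1 ?_)
    simp only at h ⊢
    rw [← coeff_pow hp, ← coeff_pow hp, h]
  · intro x
    induction x using AddMonoidAlgebra.induction_linear with
    | zero => exact ⟨0, zero_pow (Fact.out : p.Prime).ne_zero⟩
    | add x y hx hy =>
      obtain ⟨x, rfl⟩ := hx
      obtain ⟨y, rfl⟩ := hy
      exact ⟨x + y, add_pow_of_natCast_eq_zero (natCast_eq_zero hp) x y⟩
    | single m a =>
      obtain ⟨a, rfl⟩ := hR.2 a
      obtain ⟨m, rfl⟩ := Exps.nsmul_bijective.2 m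
      exact ⟨AddMonoidAlgebra.single m a, AddMonoidAlgebra.single_pow _ _ _⟩

/-! ### The degree one part of a Witt vector over R[t^(1/p^∞)]. -/

/-- The projection of `W₂(R[t])` to the Witt vectors that are homogeneous of degree one with
respect to multiplication by the Teichmüller representative of `t`. -/
def degreeOne (w : W₂ p (ExpPoly p R)) : W₂ p R :=
  W₂.teich p ((W₂red p _ w).coeff (Exps.nat p 1)) +
    W₂.ver p ((TruncatedWittVector.coeff 1 w).coeff (Exps.nat p p))

theorem red_degreeOne (w : W₂ p (ExpPoly p R)) :
    W₂red p R (degreeOne w) = (W₂red p _ w).coeff (Exps.nat p 1) := by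
  rw [degreeOne, map_add, W₂.red_teich, W₂.red_ver, add_zero]

theorem coeff_degreeOne (w : W₂ p (ExpPoly p R)) :
    (degreeOne w).coeff 1 = (TruncatedWittVector.coeff 1 w).coeff (Exps.nat p p) := by
  rw [degreeOne, W₂.coeff_add_ver, W₂.coeff_teich, zero_add]

theorem degreeOne_map {R' : Type u} [CommRing R'] (f : R →+* R') (w : W₂ p (ExpPoly p R)) :
    degreeOne (W₂map p (map p f) w) = W₂map p f (degreeOne w) :=
  W₂.ext' (by rw [red_degreeOne, W₂.red_map, W₂.red_map, red_degreeOne, coeff_map])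
    (by rw [coeff_degreeOne, W₂.coeff_map, W₂.coeff_map, coeff_degreeOne, coeff_map])

/-- Substituting rt for t multiplies the coefficient of t by r and that of t^p by r^p, and [r]·(a,
b) = (ra, r^p b). This is why degree one parts live in the Teichmüller lift of a line bundle. -/
theorem degreeOne_scale (hp : (p : R) = 0) (hR : Function.Bijective fun a : R => a ^ p) (r : R)
    (w : W₂ p (ExpPoly p R)) :
    degreeOne (W₂map p (scale hR r) w) = W₂.teich p r * degreeOne w :=
  W₂.ext' (by rw [red_degreeOne, W₂.red_map, W₂.red_teich_mul, red_degreeOne, coeff_scale,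
      expPow_nat, pow_one])
    (by rw [coeff_degreeOne, W₂.coeff_map, W₂.coeff_teich_mul hp, coeff_degreeOne, coeff_scale,
      expPow_nat])

/-- When the first component of w is ct, it agrees with that of [t]·`degreeOne w`, so the two differ
by some V(k). Adding V(k) only adds k to the second component, where the t^p term is already
accounted for. -/
theorem eq_teich_mul_degreeOne_add (hp : (p : R) = 0) {w : W₂ p (ExpPoly p R)} {c : R} (hw : W₂red p _ w = mono p 1 c) :
    ∃ k : ExpPoly p R, k.coeff (Exps.nat p p) = 0 ∧
      w = W₂.teich p (mono p 1 1) * W₂map p (ofConst p R) (degreeOne w) + W₂.ver p k := by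
  have h0 : W₂red p _ (W₂.teich p (mono p 1 1) * W₂map p (ofConst p R) (degreeOne w)) =
      W₂red p _ w := by
    rw [W₂.red_teich_mul, W₂.red_map, red_degreeOne, hw, coeff_mono, mono_mul_ofConst, one_mul]
  have h1 : W₂red p _ (w - W₂.teich p (mono p 1 1) * W₂map p (ofConst p R) (degreeOne w)) = 0 := by
    rw [map_sub, h0, sub_self]
  refine ⟨_, ?_, (add_sub_cancel _ _).symm.trans (congrArg _ (W₂.eq_ver h1))⟩
  have h2 := congrArg (TruncatedWittVector.coeff (1 : Fin 2))
    ((add_sub_cancel _ _).symm.trans (congrArg _ (W₂.eq_ver h1)))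
  rw [W₂.coeff_add_ver, W₂.coeff_teich_mul (natCast_eq_zero hp), W₂.coeff_map, coeff_degreeOne, mono_pow, one_pow,
    mono_mul_ofConst, one_mul] at h2
  have h3 := congrArg (fun x : ExpPoly p R => x.coeff (Exps.nat p p)) h2
  simp only [AddMonoidAlgebra.coeff_add, Finsupp.add_apply, coeff_mono] at h3
  exact left_eq_add.1 h3

/-- The projection to degree one turns cocycles for a twist of the action into cocycles for the
degree zero part of the twist. -/
theorem degreeOne_cocycle (hp : (p : R) = 0) {u w w₁ w₂ : W₂ p (ExpPoly p R)} {c c₁ c₂ : R}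
    (hu : W₂red p _ u = 1) (hw : W₂red p _ w = mono p 1 c) (hw₁ : W₂red p _ w₁ = mono p 1 c₁)
    (hw₂ : W₂red p _ w₂ = mono p 1 c₂) (h : w = w₁ + u * w₂) :
    degreeOne w = degreeOne w₁ + W₂map p (const p R) u * degreeOne w₂ := by
  obtain ⟨k, hk, hwk⟩ := eq_teich_mul_degreeOne_add hp hw
  obtain ⟨k₁, hk₁, hwk₁⟩ := eq_teich_mul_degreeOne_add hp hw₁
  obtain ⟨k₂, hk₂, hwk₂⟩ := eq_teich_mul_degreeOne_add hp hw₂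
  have hp' := natCast_eq_zero hp
  set u' := W₂map p (const p R) u with hu'
  have hu'1 : W₂red p R u' = 1 := by rw [hu', W₂.red_map, hu, map_one]
  have he0 : W₂red p _ (u - W₂map p (ofConst p R) u') = 0 := by
    rw [map_sub, hu, W₂.red_map, hu'1, map_one, sub_self]
  -- The Witt vector u and its constant part both reduce to 1, so they differ by some V(e), and e
  -- has no constant term.
  obtain ⟨e, he⟩ : ∃ e, u = W₂map p (ofConst p R) u' + W₂.ver p e :=
    ⟨_, (add_sub_cancel _ _).symm.trans (congrArg _ (W₂.eq_ver he0))⟩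
  have hce : const p R e = 0 := by
    have h1 := congrArg (W₂map p (const p R)) he
    rw [map_add, W₂.map_map, const_comp_ofConst, W₂.map_id, W₂.map_ver, ← hu', left_eq_add] at h1
    exact W₂.ver_injective (h1.trans (map_zero _).symm)
  set T := W₂.teich p (mono (R := R) p 1 1) with hT
  set D := degreeOne w - degreeOne w₁ - u' * degreeOne w₂ with hD
  -- Expanding the relation, u·V(k₂) = V(k₂) because u reduces to 1, and the discrepancy between u
  -- and its constant part contributes V(e·(dt)^p), with d the first component of `degreeOne w₂`.
  -- Nothing inside V on the right has a t^p term, whereas the left side is (D₀t, D₁t^p). Comparing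
  -- components gives D = 0.
  have key : T * W₂map p (ofConst p R) D =
      W₂.ver p (k₁ + k₂ - k + e * mono p p (W₂red p R (degreeOne w₂) ^ p)) := by
    have h1 : u * W₂.ver p k₂ = W₂.ver p k₂ := by
      rw [W₂.mul_ver hp', hu, one_pow, one_mul]
    have h2 : W₂.ver p e * (T * W₂map p (ofConst p R) (degreeOne w₂)) =
        W₂.ver p (e * mono p p (W₂red p R (degreeOne w₂) ^ p)) := by
      rw [W₂.ver_mul hp', hT, W₂.red_teich_mul, W₂.red_map, mono_mul_ofConst, one_mul, mono_pow]
    have h3 : T * W₂map p (ofConst p R) (degreeOne w) + W₂.ver p k =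
        T * W₂map p (ofConst p R) (degreeOne w₁) + W₂.ver p k₁ +
          (W₂map p (ofConst p R) u' * (T * W₂map p (ofConst p R) (degreeOne w₂)) +
            W₂.ver p e * (T * W₂map p (ofConst p R) (degreeOne w₂)) + u * W₂.ver p k₂) := by
      rw [← hwk, ← add_mul, ← he, ← mul_add, ← hwk₁, ← hwk₂, h]
    rw [h1, h2] at h3
    rw [AddMonoidHom.map_add, AddMonoidHom.map_sub, AddMonoidHom.map_add, hD, map_sub, map_sub,
      map_mul]
    linear_combination h3
  have hD0 : W₂red p R D = 0 := by
    have h1 := congrArg (W₂red p _) key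
    rw [W₂.red_ver, hT, W₂.red_teich_mul, W₂.red_map, mono_mul_ofConst, one_mul] at h1
    rw [← coeff_mono (p := p) 1 (W₂red p R D), h1]
    rfl
  have hD1 : TruncatedWittVector.coeff (1 : Fin 2) D = 0 := by
    have h1 := congrArg (TruncatedWittVector.coeff (1 : Fin 2)) key
    rw [W₂.coeff_ver, hT, W₂.coeff_teich_mul hp', W₂.coeff_map, mono_pow, one_pow,
      mono_mul_ofConst, one_mul] at h1
    rw [← coeff_mono (p := p) p (TruncatedWittVector.coeff (1 : Fin 2) D), h1]
    simp [hk, hk₁, hk₂, coeff_mul_mono, hce]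
  have hDz : D = 0 := by
    rw [W₂.eq_ver hD0, hD1, map_zero]
  rw [hD, sub_sub] at hDz
  exact sub_eq_zero.1 hDz

end ExpPoly
end Exponents

section

variable {G : Type v} [Group G] [TopologicalSpace G]

/-! ### Translates of open subsets -/

namespace GScheme

variable (S : GScheme.{v, u} G)

theorem translate_mul (g h : G) (U : S.X.Opens) :
    S.translate (g * h) U = S.translate g (S.translate h U) := by
  have h1 : (S.ρ (g * h)).inv = (S.ρ g).inv ≫ (S.ρ h).inv := by rw [map_mul]; rfl
  rw [translate, translate, translate, h1, Scheme.Hom.comp_preimage]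

theorem translate_of_eq_one {g : G} (hg : S.ρ g = 1) (U : S.X.Opens) : S.translate g U = U := by
  have h1 : (S.ρ g).inv = 𝟙 _ := by rw [hg]; rfl
  rw [translate, h1]
  rfl

theorem translate_one (U : S.X.Opens) : S.translate 1 U = U :=
  S.translate_of_eq_one (map_one _) U

theorem translate_mono (g : G) {U V : S.X.Opens} (h : U ≤ V) : S.translate g U ≤ S.translate g V :=
  Scheme.Hom.preimage_mono _ h

theorem le_translate_inv (g : G) (V : S.X.Opens) : V ≤ S.translate g (S.translate g⁻¹ V) := by
  rw [← translate_mul, mul_inv_cancel, translate_one]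

theorem translate_inv_le {g : G} {U V : S.X.Opens} (h : V ≤ S.translate g U) :
    S.translate g⁻¹ V ≤ U := by
  refine (S.translate_mono g⁻¹ h).trans ?_
  rw [← translate_mul, inv_mul_cancel, translate_one]

theorem le_translate_one {U V : S.X.Opens} (h : V ≤ U) : V ≤ S.translate 1 U := by
  rwa [translate_one]

theorem le_translate_mul {g h : G} {U V W : S.X.Opens} (h₁ : V ≤ S.translate h U)
    (h₂ : W ≤ S.translate g V) : W ≤ S.translate (g * h) U := by
  rw [translate_mul]
  exact h₂.trans (S.translate_mono g h₁)

end GScheme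

variable {S : GScheme.{v, u} G}

theorem res_self {𝓡 : GRing S} (M : SheafOfModules.{u} 𝓡.ringSheaf) {U : S.X.Opens} (x : msec M U)
    (h : U ≤ U) : res M h x = x := by
  have : (homOfLE h).op = 𝟙 (op U) := rfl
  rw [res, this, M.val.presheaf.map_id]
  rfl

theorem res_res {𝓡 : GRing S} (M : SheafOfModules.{u} 𝓡.ringSheaf) {U V W : S.X.Opens}
    (h : V ≤ U) (h' : W ≤ V) (x : msec M U) : res M h' (res M h x) = res M (h'.trans h) x := by
  have : (homOfLE (h'.trans h)).op = (homOfLE h).op ≫ (homOfLE h').op := rfl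
  rw [res, res, res, this, M.val.presheaf.map_comp]
  rfl

theorem GRing.act_self {𝓡 : GRing S} {U : S.X.Opens} (h : U ≤ S.translate 1 U) (a : 𝓡.sec U) :
    𝓡.act 1 U U h a = a := by
  rw [𝓡.act_one U U le_rfl]
  exact congrArg (fun f => f.hom a) (𝓡.R.obj.map_id (op U))

/-! ### Generators of a line bundle -/

section Gen

variable {𝓡 : GRing S} (L : GModule 𝓡)

/-- A generator of `L` over `V`. -/
def Gen (V : S.X.Opens) : Type u :=
  {s : msec L.M V // ∀ (W : S.X.Opens) (h : W ≤ V),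
    Function.Bijective fun a : 𝓡.sec W => a • res L.M h s}

variable {L}

theorem GModule.act_act_inv (g : G) {U V : S.X.Opens} (h : V ≤ S.translate g U)
    (h' : U ≤ S.translate g⁻¹ V) (x : msec L.M U) : L.act g⁻¹ V U h' (L.act g U V h x) = x := by
  have h1 : U ≤ S.translate (g⁻¹ * g) U := S.le_translate_mul h h'
  rw [← L.act_mul g⁻¹ g U V U h h' h1]
  -- The inclusion of opens depends on the group element, so g⁻¹g is generalised to k before it is
  -- replaced by 1.
  have key : ∀ (k : G) (hk : k = 1) (h2 : U ≤ S.translate k U), L.act k U U h2 x = x := by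
    rintro k rfl h2
    rw [L.act_one U U le_rfl, res_self]
  exact key _ (inv_mul_cancel g) h1

theorem GRing.act_act_inv (g : G) {U V : S.X.Opens} (h : V ≤ S.translate g U)
    (h' : U ≤ S.translate g⁻¹ V) (x : 𝓡.sec U) : 𝓡.act g⁻¹ V U h' (𝓡.act g U V h x) = x := by
  have h1 : U ≤ S.translate (g⁻¹ * g) U := S.le_translate_mul h h'
  rw [← 𝓡.act_mul g⁻¹ g U V U h h' h1]
  have key : ∀ (k : G) (hk : k = 1) (h2 : U ≤ S.translate k U), 𝓡.act k U U h2 x = x := by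
    rintro k rfl h2
    rw [GRing.act_self]
  exact key _ (inv_mul_cancel g) h1

theorem GRing.act_inv_act (g : G) {U V : S.X.Opens} (h : V ≤ S.translate g U)
    (h' : U ≤ S.translate g⁻¹ V) (x : 𝓡.sec V) : 𝓡.act g U V h (𝓡.act g⁻¹ V U h' x) = x := by
  have key : ∀ (k : G) (hk : k = g) (h2 : V ≤ S.translate k U),
      𝓡.act k U V h2 (𝓡.act g⁻¹ V U h' x) = x → 𝓡.act g U V h (𝓡.act g⁻¹ V U h' x) = x := by
    rintro k rfl h2 h3
    exact h3
  exact key g⁻¹⁻¹ (inv_inv g) (by rwa [inv_inv]) (GRing.act_act_inv g⁻¹ _ _ x)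

theorem GModule.act_inv_act (g : G) {U V : S.X.Opens} (h : V ≤ S.translate g U)
    (h' : U ≤ S.translate g⁻¹ V) (x : msec L.M V) : L.act g U V h (L.act g⁻¹ V U h' x) = x := by
  have key : ∀ (k : G) (hk : k = g) (h2 : V ≤ S.translate k U),
      L.act k U V h2 (L.act g⁻¹ V U h' x) = x → L.act g U V h (L.act g⁻¹ V U h' x) = x := by
    rintro k rfl h2 h3
    exact h3
  exact key g⁻¹⁻¹ (inv_inv g) (by rwa [inv_inv]) (GModule.act_act_inv g⁻¹ _ _ x)

theorem GModule.res_act (g : G) {U V W : S.X.Opens} (h : V ≤ S.translate g U) (h' : W ≤ V)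
    (x : msec L.M U) : res L.M h' (L.act g U V h x) = L.act g U W (h'.trans h) x := by
  rw [← L.act_one V W h' (S.le_translate_one h'), ← L.act_mul 1 g U V W h _
    (S.le_translate_mul h (S.le_translate_one h'))]
  have key : ∀ (k : G) (hk : k = g) (h2 : W ≤ S.translate k U),
      L.act k U W h2 x = L.act g U W (h'.trans h) x := by
    rintro k rfl h2
    rfl
  exact key _ (one_mul g) _

theorem GModule.act_res (g : G) {U V W : S.X.Opens} (h : W ≤ S.translate g V) (h' : V ≤ U)
    (x : msec L.M U) :
    L.act g V W h (res L.M h' x) = L.act g U W (h.trans (S.translate_mono g h')) x := by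
  rw [← L.act_one U V h' (S.le_translate_one h'), ← L.act_mul g 1 U V W (S.le_translate_one h') h
    (S.le_translate_mul (S.le_translate_one h') h)]
  have key : ∀ (k : G) (hk : k = g) (h2 : W ≤ S.translate k U),
      L.act k U W h2 x = L.act g U W (h.trans (S.translate_mono g h')) x := by
    rintro k rfl h2
    rfl
  exact key _ (mul_one g) _

namespace Gen

theorem ext {V : S.X.Opens} {s t : Gen L V} (h : s.1 = t.1) : s = t := Subtype.ext h

/-- The translate of a generator. -/
def act (g : G) {U V : S.X.Opens} (h : V ≤ S.translate g U) (s : Gen L U) : Gen L V :=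
  ⟨L.act g U V h s.1, fun W hW => by
    -- Over W, the translate of s corresponds to s over g⁻¹W through the inverse bijections given by
    -- g and g⁻¹, so the generator property is transported from there.
    have hWg : W ≤ S.translate g (S.translate g⁻¹ W) := S.le_translate_inv g W
    have hU : S.translate g⁻¹ W ≤ U := S.translate_inv_le (hW.trans h)
    have hact : res L.M hW (L.act g U V h s.1) = L.act g _ W hWg (res L.M hU s.1) := by
      rw [GModule.res_act, GModule.act_res]
    have hb := s.2 _ hU
    rw [hact]
    constructor
    · intro a b hab
      have h1 := congrArg (L.act g⁻¹ W (S.translate g⁻¹ W) le_rfl) hab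
      simp only [map_smulₛₗ] at h1
      rw [GModule.act_act_inv] at h1
      have h2 := congrArg (𝓡.act g (S.translate g⁻¹ W) W hWg) (hb.1 h1)
      rwa [GRing.act_inv_act, GRing.act_inv_act] at h2
    · intro x
      obtain ⟨a, ha⟩ := hb.2 (L.act g⁻¹ W (S.translate g⁻¹ W) le_rfl x)
      refine ⟨𝓡.act g (S.translate g⁻¹ W) W hWg a, ?_⟩
      have h1 := congrArg (L.act g (S.translate g⁻¹ W) W hWg) ha
      simp only [map_smulₛₗ] at h1
      rwa [GModule.act_inv_act] at h1⟩

theorem act_act (g h : G) {U V W : S.X.Opens} (h₁ : V ≤ S.translate h U)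
    (h₂ : W ≤ S.translate g V) (s : Gen L U) :
    (s.act h h₁).act g h₂ = s.act (g * h) (S.le_translate_mul h₁ h₂) :=
  Gen.ext (L.act_mul g h U V W h₁ h₂ _ s.1).symm

theorem act_inv_act (g : G) {U V : S.X.Opens} (h : V ≤ S.translate g U)
    (h' : U ≤ S.translate g⁻¹ V) (s : Gen L V) : (s.act g⁻¹ h').act g h = s :=
  Gen.ext (GModule.act_inv_act g h h' s.1)

theorem exists_smul_eq {V : S.X.Opens} (s : Gen L V) (x : msec L.M V) : ∃ a : 𝓡.sec V, a • s.1 = x := by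
  obtain ⟨a, ha⟩ := (s.2 V le_rfl).2 x
  exact ⟨a, by simpa only [res_self] using ha⟩

theorem smul_injective {V : S.X.Opens} (s : Gen L V) {a b : 𝓡.sec V} (h : a • s.1 = b • s.1) :
    a = b :=
  (s.2 V le_rfl).1 (by simpa only [res_self] using h)

/-- The coefficient of a section with respect to a generator. -/
def coef {V : S.X.Opens} (s : Gen L V) (x : msec L.M V) : 𝓡.sec V := (s.exists_smul_eq x).choose

theorem coef_smul {V : S.X.Opens} (s : Gen L V) (x : msec L.M V) : s.coef x • s.1 = x :=
  (s.exists_smul_eq x).choose_spec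

theorem coef_eq {V : S.X.Opens} (s : Gen L V) {x : msec L.M V} {a : 𝓡.sec V} (h : a • s.1 = x) :
    s.coef x = a :=
  s.smul_injective ((s.coef_smul x).trans h.symm)

theorem coef_add {V : S.X.Opens} (s : Gen L V) (x y : msec L.M V) :
    s.coef (x + y) = s.coef x + s.coef y :=
  s.coef_eq (by rw [add_smul, coef_smul, coef_smul])

theorem coef_act (g : G) {U V : S.X.Opens} (h : V ≤ S.translate g U) (s : Gen L U)
    (x : msec L.M U) : (s.act g h).coef (L.act g U V h x) = 𝓡.act g U V h (s.coef x) :=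
  coef_eq _ (by
    conv_rhs => rw [← s.coef_smul x, map_smulₛₗ]
    rfl)

end Gen

end Gen

/-! ### Families indexed by the generators of a line bundle -/

variable (S) in
/-- A presheaf of rings on a `G`-scheme with an action of `G`. -/
structure CoeffSystem where
  /-- the sections -/
  T : S.X.Opens → Type u
  [ring : ∀ U, CommRing (T U)]
  /-- the action of `G` -/
  act (g : G) (U V : S.X.Opens) (h : V ≤ S.translate g U) : T U →+* T V
  act_self (U : S.X.Opens) (h : U ≤ S.translate 1 U) (a : T U) : act 1 U U h a = a
  act_mul (g h : G) (U V W : S.X.Opens) (h₁ : V ≤ S.translate h U) (h₂ : W ≤ S.translate g V)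
    (h₃ : W ≤ S.translate (g * h) U) (a : T U) :
    act (g * h) U W h₃ a = act g V W h₂ (act h U V h₁ a)

attribute [instance] CoeffSystem.ring

section Families

variable {𝓡 : GRing S} (L : GModule 𝓡) (C : CoeffSystem S)

/-- Families of elements of `C(V)`, for all opens `V ≤ U` and all generators of `L` over `V`. -/
abbrev Family (U : S.X.Opens) : Type u :=
  ∀ V : {V : S.X.Opens // V ≤ U}, Gen L V.1 → C.T V.1

variable {L C}

/-- A family is homogeneous if it is compatible with restrictions, and if its
dependence on the generator is given by the operators `σ`. -/
structure IsHomogeneous (σ : ∀ V : S.X.Opens, 𝓡.sec V → C.T V → C.T V) {U : S.X.Opens}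
    (f : Family L C U) : Prop where
  natural (V W : S.X.Opens) (hV : V ≤ U) (hW : W ≤ V) (s : Gen L V) :
    f ⟨W, hW.trans hV⟩ (s.act 1 (S.le_translate_one hW)) =
      C.act 1 V W (S.le_translate_one hW) (f ⟨V, hV⟩ s)
  homogeneous (V : S.X.Opens) (hV : V ≤ U) (s t : Gen L V) (r : 𝓡.sec V) (h : t.1 = r • s.1) :
    f ⟨V, hV⟩ s = σ V r (f ⟨V, hV⟩ t)

/-- The translate of a family. -/
def Family.act (g : G) {U U' : S.X.Opens} (h : U' ≤ S.translate g U) (f : Family L C U) :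
    Family L C U' := fun V s =>
  C.act g (S.translate g⁻¹ V) V (S.le_translate_inv g V)
    (f ⟨_, S.translate_inv_le (V.2.trans h)⟩ (s.act g⁻¹ le_rfl))

variable {σ : ∀ V : S.X.Opens, 𝓡.sec V → C.T V → C.T V} {U : S.X.Opens}

theorem CoeffSystem.act_congr {g h : G} (hgh : g = h) {U V : S.X.Opens}
    (h₁ : V ≤ S.translate g U) (h₂ : V ≤ S.translate h U) (x : C.T U) :
    C.act g U V h₁ x = C.act h U V h₂ x := by
  subst hgh
  rfl

theorem Gen.act_congr {g h : G} (hgh : g = h) {U V : S.X.Opens}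
    (h₁ : V ≤ S.translate g U) (h₂ : V ≤ S.translate h U) (s : Gen L U) :
    s.act g h₁ = s.act h h₂ := by
  subst hgh
  rfl

/-- `Family.act` evaluates exactly at g⁻¹V and g⁻¹s. Naturality allows instead any open W with V ⊆
gW and any generator over W that translates to s. -/
theorem IsHomogeneous.act_apply {f : Family L C U} (hf : IsHomogeneous σ f) (g : G)
    {U' : S.X.Opens} (h : U' ≤ S.translate g U) {V W : S.X.Opens} (hV : V ≤ U') (hW : W ≤ U)
    (hVW : V ≤ S.translate g W) (s : Gen L V) (t : Gen L W) (hs : s = t.act g hVW) :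
    f.act g h ⟨V, hV⟩ s = C.act g W V hVW (f ⟨W, hW⟩ t) := by
  have hW' : S.translate g⁻¹ V ≤ W := S.translate_inv_le hVW
  have h1 : s.act g⁻¹ le_rfl = t.act 1 (S.le_translate_one hW') := by
    rw [hs, Gen.act_act]
    exact Gen.act_congr (inv_mul_cancel g) _ _ _
  rw [Family.act, h1, hf.natural W _ hW hW' t, ← C.act_mul g 1 W _ V _ _
    (S.le_translate_mul (S.le_translate_one hW') (S.le_translate_inv g V))]
  exact CoeffSystem.act_congr (mul_one g) _ _ _

theorem IsHomogeneous.act {f : Family L C U} (hf : IsHomogeneous σ f)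
    (hσ : ∀ (g : G) (U V : S.X.Opens) (h : V ≤ S.translate g U) (r : 𝓡.sec U) (x : C.T U),
      C.act g U V h (σ U r x) = σ V (𝓡.act g U V h r) (C.act g U V h x)) (g : G)
    {U' : S.X.Opens} (h : U' ≤ S.translate g U) : IsHomogeneous σ (f.act g h) where
  natural V W hV hW s := by
    have hWV : W ≤ S.translate g (S.translate g⁻¹ V) := hW.trans (S.le_translate_inv g V)
    rw [hf.act_apply g h (hW.trans hV) (S.translate_inv_le (hV.trans h)) hWV _
      (s.act g⁻¹ le_rfl) ?_]
    · rw [Family.act, ← C.act_mul 1 g _ _ _ _ _ (S.le_translate_mul (S.le_translate_inv g V)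
        (S.le_translate_one hW))]
      exact CoeffSystem.act_congr (one_mul g).symm _ _ _
    · rw [Gen.act_act]
      exact Gen.act_congr (mul_inv_cancel g).symm _ _ _
  homogeneous V hV s t r hst := by
    rw [Family.act, Family.act, hf.homogeneous _ _ _ (t.act g⁻¹ le_rfl)
      (𝓡.act g⁻¹ V (S.translate g⁻¹ V) le_rfl r), hσ, GRing.act_inv_act]
    change L.act _ _ _ _ t.1 = _
    rw [hst, map_smulₛₗ]
    rfl

theorem IsHomogeneous.act_act {f : Family L C U} (hf : IsHomogeneous σ f) (g h : G)
    {V W : S.X.Opens} (h₁ : V ≤ S.translate h U) (h₂ : W ≤ S.translate g V) :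
    (f.act h h₁).act g h₂ = f.act (g * h) (S.le_translate_mul h₁ h₂) := by
  funext ⟨Y, hY⟩ s
  have hY1 : S.translate g⁻¹ Y ≤ V := S.translate_inv_le (hY.trans h₂)
  have hY2 := S.le_translate_inv h (S.translate g⁻¹ Y)
  have hY3 := S.le_translate_mul hY2 (S.le_translate_inv g Y)
  rw [hf.act_apply (g * h) _ hY (S.translate_inv_le (hY1.trans h₁)) hY3 s
    ((s.act g⁻¹ le_rfl).act h⁻¹ le_rfl), Family.act, Family.act, ← C.act_mul]
  rw [Gen.act_act, Gen.act_act]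
  refine Gen.ext ?_
  rw [Gen.act_congr (h := 1) (by group) _ (S.le_translate_one le_rfl)]
  exact ((L.act_one Y Y le_rfl _ s.1).trans (res_self _ _ _)).symm

theorem IsHomogeneous.act_of_trivial {f : Family L C U} (hf : IsHomogeneous σ f) {g : G}
    {U' : S.X.Opens} (h : U' ≤ S.translate g U) (hU : U' ≤ U) {V : S.X.Opens} (hV : V ≤ U')
    (hVg : V ≤ S.translate g V) (hL : ∀ x : msec L.M V, L.act g V V hVg x = x)
    (hC : ∀ x : C.T V, C.act g V V hVg x = x) (s : Gen L V) :
    f.act g h ⟨V, hV⟩ s = f ⟨V, hV.trans hU⟩ s := by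
  rw [hf.act_apply g h hV (hV.trans hU) hVg s s (Gen.ext (hL s.1).symm), hC]

theorem IsHomogeneous.act_one {f : Family L C U} (hf : IsHomogeneous σ f)
    {U' : S.X.Opens} (h : U' ≤ S.translate 1 U) (hU : U' ≤ U) {V : S.X.Opens} (hV : V ≤ U')
    (s : Gen L V) : f.act 1 h ⟨V, hV⟩ s = f ⟨V, hV.trans hU⟩ s :=
  hf.act_of_trivial h hU hV (S.le_translate_one le_rfl)
    (fun x => (L.act_one V V le_rfl _ x).trans (res_self _ _ _)) (fun x => C.act_self V _ x) s

end Families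

end

section

variable {G : Type v} [Group G] [TopologicalSpace G] {S : GScheme.{v, u} G}

/-! ### The ring of homogeneous functions -/

/-- Witt vectors of length two, as a coefficient system. -/
def wittCoeff (p : ℕ) [Fact p.Prime] (𝓡 : GRing S) : CoeffSystem S where
  T V := W₂ p (𝓡.sec V)
  act g U V h := W₂map p (𝓡.act g U V h)
  act_self U h a := by
    have : 𝓡.act 1 U U h = RingHom.id _ := RingHom.ext fun a => GRing.act_self h a
    rw [this, W₂.map_id]
  act_mul g h U V W h₁ h₂ h₃ a := by
    have : 𝓡.act (g * h) U W h₃ = (𝓡.act g V W h₂).comp (𝓡.act h U V h₁) :=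
      RingHom.ext fun a => 𝓡.act_mul g h U V W h₁ h₂ h₃ a
    rw [this, W₂.map_map]

/-- Multiplication of Witt vectors of length two by Teichmüller representatives. -/
def teichScale (p : ℕ) [Fact p.Prime] (𝓡 : GRing S) (V : S.X.Opens) (r : 𝓡.sec V)
    (x : W₂ p (𝓡.sec V)) : W₂ p (𝓡.sec V) :=
  W₂.teich p r * x

/-- Polynomials with exponents in `ℕ[1/p]`, as a coefficient system. -/
def expCoeff (p : ℕ) (𝓡 : GRing S) : CoeffSystem S where
  T V := ExpPoly p (𝓡.sec V)
  act g U V h := ExpPoly.map p (𝓡.act g U V h)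
  act_self U h a := AddMonoidAlgebra.coeff_injective <| Finsupp.ext fun q => by
    rw [ExpPoly.coeff_map, GRing.act_self]
  act_mul g h U V W h₁ h₂ h₃ a := AddMonoidAlgebra.coeff_injective <| Finsupp.ext fun q => by
    rw [ExpPoly.coeff_map, ExpPoly.coeff_map, ExpPoly.coeff_map, ← 𝓡.act_mul]

/-- An action on a sheaf of rings is naive if an open subgroup acts trivially. -/
def GRing.IsNaive (𝓡 : GRing S) : Prop :=
  ∃ N : OpenSubgroup G, ∀ g ∈ N, S.ρ g = 1 ∧
    ∀ (U : S.X.Opens) (h : U ≤ S.translate g U) (a : 𝓡.sec U), 𝓡.act g U U h a = a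

variable {p : ℕ} {𝓡 : GRing S} (L : GModule 𝓡)
  (hR : ∀ U : S.X.Opens, Function.Bijective fun a : 𝓡.sec U => a ^ p)

/-- The ring of homogeneous families of polynomials with exponents in `ℕ[1/p]`: the direct sum of
the groups of global sections of the powers of `L` with these exponents. -/
def homogeneousRing : Subring (Family L (expCoeff p 𝓡) ⊤) where
  carrier := {f | IsHomogeneous (fun V r => ExpPoly.scale (hR V) r) f}
  zero_mem' := ⟨fun V W hV hW s => (map_zero _).symm, fun V hV s t r h => (map_zero _).symm⟩
  one_mem' := ⟨fun V W hV hW s => (map_one _).symm, fun V hV s t r h => (map_one _).symm⟩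
  add_mem' := fun {x y} hx hy =>
    ⟨fun V W hV hW s => by
      simp only [Pi.add_apply]
      rw [map_add, hx.natural V W hV hW s, hy.natural V W hV hW s],
    fun V hV s t r h => by
      simp only [Pi.add_apply]
      rw [hx.homogeneous V hV s t r h, hy.homogeneous V hV s t r h]
      exact (map_add (ExpPoly.scale (hR V) r) _ _).symm⟩
  mul_mem' := fun {x y} hx hy =>
    ⟨fun V W hV hW s => by
      simp only [Pi.mul_apply]
      rw [map_mul, hx.natural V W hV hW s, hy.natural V W hV hW s],
    fun V hV s t r h => by
      simp only [Pi.mul_apply]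
      rw [hx.homogeneous V hV s t r h, hy.homogeneous V hV s t r h]
      exact (map_mul (ExpPoly.scale (hR V) r) _ _).symm⟩
  neg_mem' := fun {x} hx =>
    ⟨fun V W hV hW s => by
      simp only [Pi.neg_apply]
      rw [map_neg, hx.natural V W hV hW s],
    fun V hV s t r h => by
      simp only [Pi.neg_apply]
      rw [hx.homogeneous V hV s t r h]
      exact (map_neg (ExpPoly.scale (hR V) r) _).symm⟩

namespace homogeneousRing

variable {L hR}

instance : CommRing (homogeneousRing L hR) := Subring.toCommRing _

theorem act_mem {f : Family L (expCoeff p 𝓡) ⊤} (hf : f ∈ homogeneousRing L hR) (g : G) :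
    f.act g (U' := ⊤) le_rfl ∈ homogeneousRing L hR :=
  IsHomogeneous.act hf (fun _ U V _ r x => ExpPoly.map_scale (hR U) (hR V) _ r x) g le_rfl

instance : MulSemiringAction G (homogeneousRing L hR) where
  smul g f := ⟨f.1.act g le_rfl, act_mem f.2 g⟩
  one_smul f := Subtype.ext <| funext fun V => funext fun s =>
    IsHomogeneous.act_one f.2 le_rfl le_rfl V.2 s
  mul_smul g h f := Subtype.ext (IsHomogeneous.act_act f.2 g h le_rfl le_rfl).symm
  smul_zero _ := Subtype.ext <| funext fun _ => funext fun _ => map_zero _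
  smul_add _ _ _ := Subtype.ext <| funext fun _ => funext fun _ => map_add _ _ _
  smul_one _ := Subtype.ext <| funext fun _ => funext fun _ => map_one _
  smul_mul _ _ _ := Subtype.ext <| funext fun _ => funext fun _ => map_mul _ _ _

theorem natCast_eq_zero (hp : ∀ U : S.X.Opens, (p : 𝓡.sec U) = 0) :
    (p : homogeneousRing L hR) = 0 :=
  Subtype.ext <| funext fun V => funext fun _ =>
    ExpPoly.natCast_eq_zero (hp V.1)

/-- Roots are taken value by value; as they are unique, the family of roots inherits naturality and
homogeneity. -/
theorem pow_bijective [Fact p.Prime] (hp : ∀ U : S.X.Opens, (p : 𝓡.sec U) = 0) :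
    Function.Bijective fun a : homogeneousRing L hR => a ^ p := by
  have hb := fun V => ExpPoly.pow_bijective (hp V) (hR V)
  constructor
  · intro x y h
    refine Subtype.ext <| funext fun V => funext fun s => (hb V.1).1 ?_
    exact congrArg (fun a : homogeneousRing L hR => a.1 V s) h
  · intro x
    choose y hy using fun (V : {V : S.X.Opens // V ≤ ⊤}) s => (hb V.1).2 (x.1 V s)
    refine ⟨⟨y, ⟨fun V W hV hW s => (hb W).1 ?_, fun V hV s t r h => (hb V).1 ?_⟩⟩,
      Subtype.ext <| funext fun V => funext fun s => hy V s⟩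
    · refine (hy _ _).trans ?_
      rw [x.2.natural V W hV hW s, ← hy]
      exact map_pow _ _ _
    · refine (hy _ _).trans ?_
      rw [x.2.homogeneous V hV s t r h, ← hy]
      exact map_pow _ _ _

theorem isNaive (h𝓡 : 𝓡.IsNaive) : IsNaive G (homogeneousRing L hR) := by
  obtain ⟨N₁, hN₁⟩ := h𝓡
  obtain ⟨N₂, hN₂⟩ := L.naive
  refine ⟨N₁ ⊓ N₂, fun g hg x => Subtype.ext <| funext fun V => funext fun s => ?_⟩
  have hV : V.1 ≤ S.translate g V.1 := (S.translate_of_eq_one (hN₁ g hg.1).1 V.1).ge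
  refine IsHomogeneous.act_of_trivial x.2 le_rfl le_rfl V.2 hV (fun y => ?_) (fun y => ?_) s
  · rw [hN₂ g hg.2 V.1 V.1 le_rfl, res_self]
  · refine AddMonoidAlgebra.coeff_injective <| Finsupp.ext fun q => ?_
    exact (ExpPoly.coeff_map _ _ _).trans ((hN₁ g hg.1).2 V.1 hV _)

/-- A global section of `L`, as a homogeneous family of degree one. -/
def ofSection (hR : ∀ U : S.X.Opens, Function.Bijective fun a : 𝓡.sec U => a ^ p) :
    msec L.M ⊤ →+ homogeneousRing L hR where
  toFun x := ⟨fun V s => ExpPoly.mono p 1 (s.coef (res L.M V.2 x)),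
    ⟨fun V W hV hW s => by
      refine Eq.trans ?_ (ExpPoly.map_mono _ 1 _).symm
      rw [← Gen.coef_act]
      congr 2
      rw [GModule.act_res, L.act_one ⊤ W (hW.trans hV)],
    fun V hV s t r h => by
      refine Eq.trans ?_ (ExpPoly.scale_mono (hR V) r 1 _).symm
      rw [pow_one]
      congr 1
      refine s.coef_eq ?_
      rw [mul_comm, mul_smul, ← h, Gen.coef_smul]⟩⟩
  map_zero' := Subtype.ext <| funext fun V => funext fun s => by
    have h : s.coef 0 = 0 := s.coef_eq (zero_smul _ _)
    simp only [map_zero, h]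
    rfl
  map_add' x y := Subtype.ext <| funext fun V => funext fun s => by
    simp only [map_add, Gen.coef_add]
    rfl

theorem smul_ofSection (g : G) (x : msec L.M ⊤) :
    g • ofSection hR x = ofSection hR (L.act g ⊤ ⊤ le_rfl x) :=
  Subtype.ext <| funext fun V => funext fun s => by
    refine (ExpPoly.map_mono _ 1 _).trans ?_
    rw [← Gen.coef_act, Gen.act_inv_act, GModule.act_res, ← GModule.res_act (h := le_rfl)]
    rfl

/-- The value of a family at a generator. -/
def eval {V : S.X.Opens} (s : Gen L V) : homogeneousRing L hR →+* ExpPoly p (𝓡.sec V) :=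
  (Pi.evalRingHom _ s).comp ((Pi.evalRingHom _ (⟨V, le_top⟩ : {V : S.X.Opens // V ≤ ⊤})).comp
    (homogeneousRing L hR).subtype)

theorem eval_act_one {V W : S.X.Opens} (h : W ≤ V) (s : Gen L V) :
    eval (hR := hR) (s.act 1 (S.le_translate_one h)) =
      (ExpPoly.map p (𝓡.act 1 V W (S.le_translate_one h))).comp (eval s) :=
  RingHom.ext fun f => f.2.natural V W le_top h s

theorem eval_of_smul {V : S.X.Opens} (s t : Gen L V) (r : 𝓡.sec V) (h : t.1 = r • s.1) :
    eval (hR := hR) s = (ExpPoly.scale (hR V) r).comp (eval t) :=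
  RingHom.ext fun f => f.2.homogeneous V le_top s t r h

theorem eval_comp_smul (g : G) {V : S.X.Opens} (s : Gen L V) :
    (eval s).comp (MulSemiringAction.toRingHom G (homogeneousRing L hR) g) =
      (ExpPoly.map p (𝓡.act g (S.translate g⁻¹ V) V (S.le_translate_inv g V))).comp
        (eval (s.act g⁻¹ le_rfl)) := rfl

/-! ### Degree zero and degree one parts of Witt vectors over the homogeneous ring. -/

section Witt

variable [Fact p.Prime]

/-- The degree zero part of a Witt vector with components in the ring of homogeneous families. -/
def degreeZero (x : W₂ p (homogeneousRing L hR)) : Family L (wittCoeff p 𝓡) ⊤ := fun V s =>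
  W₂map p (ExpPoly.const p (𝓡.sec V.1)) (W₂map p (eval s) x)

/-- The degree one part of a Witt vector with components in the ring of homogeneous families. -/
def degreeOne (x : W₂ p (homogeneousRing L hR)) : Family L (wittCoeff p 𝓡) ⊤ := fun _ s =>
  ExpPoly.degreeOne (W₂map p (eval s) x)

/-- Constant terms are unchanged by the substitution of rt for t, so the degree zero part does not
depend on the generator and behaves as a section of W₂(𝓡). -/
theorem isHomogeneous_degreeZero (x : W₂ p (homogeneousRing L hR)) :
    IsHomogeneous (fun _ _ y => y) (degreeZero x) where
  natural V W hV hW s := by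
    have h1 : ((ExpPoly.const p (𝓡.sec W)).comp
          (ExpPoly.map p (𝓡.act 1 V W (S.le_translate_one hW)))) =
        (𝓡.act 1 V W (S.le_translate_one hW)).comp (ExpPoly.const p (𝓡.sec V)) :=
      RingHom.ext fun f => ExpPoly.const_map _ _
    change W₂map p (ExpPoly.const p (𝓡.sec W))
        (W₂map p (eval (s.act 1 (S.le_translate_one hW))) x) =
      W₂map p (𝓡.act 1 V W (S.le_translate_one hW))
        (W₂map p (ExpPoly.const p (𝓡.sec V)) (W₂map p (eval s) x))
    rw [eval_act_one hW, ← W₂.map_map (eval s), W₂.map_map _ (ExpPoly.const p _), h1, ← W₂.map_map]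
  homogeneous V hV s t r h := by
    have h1 : (ExpPoly.const p (𝓡.sec V)).comp (ExpPoly.scale (hR V) r) =
        ExpPoly.const p (𝓡.sec V) :=
      RingHom.ext fun f => ExpPoly.const_scale _ _ _
    change W₂map p (ExpPoly.const p (𝓡.sec V)) (W₂map p (eval s) x) =
      W₂map p (ExpPoly.const p (𝓡.sec V)) (W₂map p (eval t) x)
    rw [eval_of_smul s t r h, ← W₂.map_map (eval t), W₂.map_map _ (ExpPoly.const p _), h1]

/-- By `ExpPoly.degreeOne_scale`, a change of generator by r multiplies the degree one part by [r],
which is the transition rule of the Teichmüller lift. -/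
theorem isHomogeneous_degreeOne (hp : ∀ U : S.X.Opens, (p : 𝓡.sec U) = 0)
    (x : W₂ p (homogeneousRing L hR)) : IsHomogeneous (teichScale p 𝓡) (degreeOne x) where
  natural V W hV hW s := by
    change ExpPoly.degreeOne (W₂map p (eval (s.act 1 (S.le_translate_one hW))) x) =
      W₂map p (𝓡.act 1 V W (S.le_translate_one hW)) (ExpPoly.degreeOne (W₂map p (eval s) x))
    rw [eval_act_one hW, ← W₂.map_map, ExpPoly.degreeOne_map]
  homogeneous V hV s t r h := by
    change ExpPoly.degreeOne (W₂map p (eval s) x) =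
      W₂.teich p r * ExpPoly.degreeOne (W₂map p (eval t) x)
    rw [eval_of_smul s t r h, ← W₂.map_map, ExpPoly.degreeOne_scale (hp V)]

theorem map_eval_map_smul (g : G) {V : S.X.Opens} (s : Gen L V)
    (x : W₂ p (homogeneousRing L hR)) :
    W₂map p (eval s) (W₂map p (MulSemiringAction.toRingHom G (homogeneousRing L hR) g) x) =
      W₂map p (ExpPoly.map p (𝓡.act g (S.translate g⁻¹ V) V (S.le_translate_inv g V)))
        (W₂map p (eval (s.act g⁻¹ le_rfl)) x) := by
  rw [W₂.map_map, W₂.map_map, eval_comp_smul]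

theorem degreeZero_smul (g : G) (x : W₂ p (homogeneousRing L hR)) :
    degreeZero (W₂map p (MulSemiringAction.toRingHom G (homogeneousRing L hR) g) x) =
      (degreeZero x).act (U' := ⊤) g le_rfl := by
  funext V s
  have h1 : ((ExpPoly.const p (𝓡.sec V.1)).comp
        (ExpPoly.map p (𝓡.act g (S.translate g⁻¹ V) V (S.le_translate_inv g V)))) =
      (𝓡.act g (S.translate g⁻¹ V) V (S.le_translate_inv g V)).comp (ExpPoly.const p _) :=
    RingHom.ext fun f => ExpPoly.const_map _ _
  refine (congrArg _ (map_eval_map_smul g s x)).trans ?_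
  rw [W₂.map_map, h1, ← W₂.map_map]
  rfl

theorem degreeOne_smul (g : G) (x : W₂ p (homogeneousRing L hR)) :
    degreeOne (W₂map p (MulSemiringAction.toRingHom G (homogeneousRing L hR) g) x) =
      (degreeOne x).act (U' := ⊤) g le_rfl := by
  funext V s
  refine (congrArg ExpPoly.degreeOne (map_eval_map_smul g s x)).trans ?_
  rw [ExpPoly.degreeOne_map]
  rfl

theorem degreeZero_mul (x y : W₂ p (homogeneousRing L hR)) :
    degreeZero (x * y) = degreeZero x * degreeZero y := by
  funext V s
  refine (congrArg _ (map_mul (W₂map p (eval s)) x y)).trans ?_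
  exact map_mul (W₂map p (ExpPoly.const p (𝓡.sec V.1))) _ _

theorem degreeZero_one : degreeZero (1 : W₂ p (homogeneousRing L hR)) = 1 := by
  funext V s
  refine (congrArg _ (map_one (W₂map p (eval s)))).trans ?_
  exact map_one (W₂map p (ExpPoly.const p (𝓡.sec V.1)))

theorem degreeOne_zero : degreeOne (0 : W₂ p (homogeneousRing L hR)) = 0 := by
  funext V s
  refine (congrArg ExpPoly.degreeOne (map_zero (W₂map p (eval s)))).trans ?_
  refine W₂.ext' ?_ ?_
  · rw [ExpPoly.red_degreeOne, map_zero]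
    exact (map_zero (W₂red p (𝓡.sec V.1))).symm
  · rw [ExpPoly.coeff_degreeOne, TruncatedWittVector.coeff_zero]
    exact (TruncatedWittVector.coeff_zero (p := p) 2 (𝓡.sec V.1) 1).symm

theorem degreeOne_cocycle (hp : ∀ U : S.X.Opens, (p : 𝓡.sec U) = 0)
    {u w w₁ w₂ : W₂ p (homogeneousRing L hR)} {c c₁ c₂ : msec L.M ⊤}
    (hu : W₂red p _ u = 1) (hw : W₂red p _ w = ofSection hR c)
    (hw₁ : W₂red p _ w₁ = ofSection hR c₁) (hw₂ : W₂red p _ w₂ = ofSection hR c₂)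
    (h : w = w₁ + u * w₂) : degreeOne w = degreeOne w₁ + degreeZero u * degreeOne w₂ := by
  funext V s
  refine ExpPoly.degreeOne_cocycle (hp V.1) (u := W₂map p (eval s) u)
    (c := s.coef (res L.M V.2 c)) (c₁ := s.coef (res L.M V.2 c₁))
    (c₂ := s.coef (res L.M V.2 c₂)) ?_ ?_ ?_ ?_ ?_
  · rw [W₂.red_map, hu, map_one]
  · rw [W₂.red_map, hw]
    rfl
  · rw [W₂.red_map, hw₁]
    rfl
  · rw [W₂.red_map, hw₂]
    rfl
  · rw [h, map_add, map_mul]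

end Witt

end homogeneousRing

open homogeneousRing in
/-- If `G` is `(1,1)`-smooth, then every cocycle with values in the global sections of a line
bundle `L` over a perfect sheaf of rings `𝓡` lifts to a cocycle for a twist of the Teichmüller
lift of `L`. -/
theorem IsOneOneSmooth.exists_twist_family [IsTopologicalGroup G] [Fact p.Prime]
    (hG : IsOneOneSmooth.{v, u} G p)
    (hR : ∀ U : S.X.Opens, Function.Bijective fun a : 𝓡.sec U => a ^ p)
    (hp : ∀ U : S.X.Opens, (p : 𝓡.sec U) = 0) (h𝓡 : 𝓡.IsNaive) {c : G → msec L.M ⊤}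
    (hc : ∀ g h, c (g * h) = c g + L.act g ⊤ ⊤ le_rfl (c h))
    (hcN : ∃ N : OpenSubgroup G, ∀ g ∈ N, c g = 0) :
    ∃ u w : G → Family L (wittCoeff p 𝓡) ⊤,
      (∀ g, IsHomogeneous (fun _ _ x => x) (u g)) ∧
      (∀ g (V : {V : S.X.Opens // V ≤ ⊤}) (s : Gen L V.1), W₂red p (𝓡.sec V.1) (u g V s) = 1) ∧
      (∀ g h, u (g * h) = u g * (u h).act (U' := ⊤) g le_rfl) ∧
      (∀ g, IsHomogeneous (teichScale p 𝓡) (w g)) ∧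
      (∀ g (V : {V : S.X.Opens // V ≤ ⊤}) (s : Gen L V.1), W₂red p (𝓡.sec V.1) (w g V s) =
        s.coef (res L.M V.2 (c g))) ∧
      (∀ g h, w (g * h) = w g + u g * (w h).act (U' := ⊤) g le_rfl) ∧
      ∃ N : OpenSubgroup G, ∀ g ∈ N, u g = 1 ∧ w g = 0 := by
  obtain ⟨N, hN⟩ := hcN
  have hc' : (fun g => ofSection hR (c g)) ∈ Z1 G (homogeneousRing L hR) := by
    refine ⟨IsLocallyConstant.comp ?_ (ofSection hR), fun g h => ?_⟩
    -- The cocycle relation makes c constant on each coset gN.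
    · refine (IsLocallyConstant.iff_exists_open _).2 fun g => ⟨(fun h => g⁻¹ * h) ⁻¹' N,
        N.isOpen.preimage (continuous_const_mul _), by simp [one_mem], fun h hh => ?_⟩
      have := hc g (g⁻¹ * h)
      rwa [hN _ hh, map_zero, add_zero, mul_inv_cancel_left] at this
    · simp only
      rw [hc, map_add, smul_ofSection]
  -- The passage from S to a ring: smoothness is used for the ring of homogeneous families, in which
  -- c takes values of degree one.
  obtain ⟨u, w, hu, hw, hu', hw', N', hN'⟩ :=
    hG.exists_twist (natCast_eq_zero hp) (pow_bijective hp) (isNaive h𝓡) hc'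
  refine ⟨fun g => degreeZero (u g), fun g => degreeOne (w g),
    fun g => isHomogeneous_degreeZero _, fun g _ _ => ?_, fun g h => ?_,
    fun g => isHomogeneous_degreeOne hp _, fun g V s => ?_, fun g h => ?_, N', fun g hg => ?_⟩
  · refine (W₂.red_map _ _).trans ?_
    rw [W₂.red_map, hu, map_one, map_one]
  · beta_reduce
    rw [hu', degreeZero_mul, degreeZero_smul]
  · refine (ExpPoly.red_degreeOne _).trans ?_
    rw [W₂.red_map, hw]
    exact ExpPoly.coeff_mono 1 _
  · beta_reduce
    rw [← degreeOne_smul]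
    refine degreeOne_cocycle hp (c₂ := L.act g ⊤ ⊤ le_rfl (c h)) (hu g) (hw _) (hw g) ?_ (hw' g h)
    rw [W₂.red_map, hw, ← smul_ofSection]
    rfl
  · beta_reduce
    rw [(hN' g hg).1, (hN' g hg).2]
    exact ⟨degreeZero_one, degreeOne_zero⟩

end

section

variable {G : Type v} [Group G] [TopologicalSpace G] {S : GScheme.{v, u} G}

/-! ### Construction of sheaves of modules -/

/-- Unique gluing for a presheaf of sets, given by its sections and restriction maps. -/
def HasGluing (F : S.X.Opens → Type u) (r : ∀ {U V : S.X.Opens}, V ≤ U → F U → F V) : Prop :=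
  ∀ (ι : Type u) (U : ι → S.X.Opens) (V : S.X.Opens) (hU : ∀ i, U i ≤ V) (_ : V ≤ iSup U)
    (s : ∀ i, F (U i)), (∀ i j, r (inf_le_left : U i ⊓ U j ≤ U i) (s i) = r inf_le_right (s j)) →
    ∃! t : F V, ∀ i, r (hU i) t = s i

theorem msec_hasGluing {𝓡 : GRing S} (M : SheafOfModules.{u} 𝓡.ringSheaf) :
    HasGluing (msec M) (fun h x => res M h x) := by
  intro ι U V hU hV s hs
  obtain rfl : V = iSup U := le_antisymm hV (iSup_le hU)
  have h1 : TopCat.Presheaf.IsSheaf (C := AddCommGrpCat.{u}) (X := S.X) M.val.presheaf := M.isSheaf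
  let s' : ∀ i, ToType (M.val.presheaf.obj (op (U i))) := s
  exact TopCat.Presheaf.IsSheaf.isSheafUniqueGluing h1 U s' hs

theorem HasGluing.prod {F F' : S.X.Opens → Type u} {r : ∀ {U V : S.X.Opens}, V ≤ U → F U → F V}
    {r' : ∀ {U V : S.X.Opens}, V ≤ U → F' U → F' V} (h : HasGluing F r) (h' : HasGluing F' r') :
    HasGluing (fun U => F U × F' U) (fun h x => (r h x.1, r' h x.2)) := by
  intro ι U V hU hV s hs
  obtain ⟨x, hx, hx'⟩ := h ι U V hU hV (fun i => (s i).1) fun i j => congrArg Prod.fst (hs i j)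
  obtain ⟨y, hy, hy'⟩ := h' ι U V hU hV (fun i => (s i).2) fun i j => congrArg Prod.snd (hs i j)
  exact ⟨(x, y), fun i => Prod.ext (hx i) (hy i), fun z hz => Prod.ext
    (hx' _ fun i => congrArg Prod.fst (hz i)) (hy' _ fun i => congrArg Prod.snd (hz i))⟩

/-- The sections and the restriction maps of a sheaf of modules. -/
structure ModuleData (𝓡 : GRing S) where
  /-- the sections -/
  F : S.X.Opens → Type u
  [addCommGroup : ∀ U, AddCommGroup (F U)]
  [module : ∀ U, Module (𝓡.sec U) (F U)]
  /-- the restriction maps -/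
  r : ∀ {U V : S.X.Opens}, V ≤ U → F U →+ F V
  r_self : ∀ {U : S.X.Opens} (h : U ≤ U) (x : F U), r h x = x
  r_r : ∀ {U V W : S.X.Opens} (h : V ≤ U) (h' : W ≤ V) (x : F U), r h' (r h x) = r (h'.trans h) x
  r_smul : ∀ {U V : S.X.Opens} (h : V ≤ U) (a : 𝓡.sec U) (x : F U),
    r h (a • x) = (𝓡.R.obj.map (homOfLE h).op a : 𝓡.sec V) • r h x
  gluing : HasGluing F (fun h x => r h x)

attribute [instance] ModuleData.addCommGroup ModuleData.module

namespace ModuleData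

variable {𝓡 : GRing S} (D : ModuleData 𝓡)

/-- The underlying presheaf of abelian groups. -/
def presheaf : (Opens S.X)ᵒᵖ ⥤ AddCommGrpCat.{u} where
  obj U := AddCommGrpCat.of (D.F U.unop)
  map f := AddCommGrpCat.ofHom (D.r f.unop.le)
  map_id U := by
    ext x
    exact D.r_self _ x
  map_comp f g := by
    ext x
    exact (D.r_r _ _ x).symm

instance (U : (Opens S.X)ᵒᵖ) : Module (𝓡.ringSheaf.obj.obj U) (D.presheaf.obj U) :=
  D.module U.unop

/-- The associated sheaf of modules. -/
def toSheafOfModules : SheafOfModules.{u} 𝓡.ringSheaf where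
  val := PresheafOfModules.ofPresheaf D.presheaf fun _ _ f a x => D.r_smul f.unop.le a x
  isSheaf := by
    change TopCat.Presheaf.IsSheaf (C := AddCommGrpCat.{u}) (X := S.X) D.presheaf
    rw [TopCat.Presheaf.isSheaf_iff_isSheafUniqueGluing]
    intro ι U sf hsf
    exact D.gluing ι U (iSup U) (le_iSup U) le_rfl sf hsf

end ModuleData

variable {𝓡 : GRing S} {M N : SheafOfModules.{u} 𝓡.ringSheaf}

/-- A morphism of sheaves of modules, from its action on sections. -/
def homMk (f : ∀ U : S.X.Opens, msec M U →ₗ[𝓡.sec U] msec N U)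
    (hf : ∀ {U V : S.X.Opens} (h : V ≤ U) (x : msec M U), f V (res M h x) = res N h (f U x)) :
    M ⟶ N where
  val :=
    { app := fun U => ModuleCat.ofHom (f U.unop)
      naturality := fun {U V} i => by
        ext x
        exact hf i.unop.le x }

theorem sheafHom_ext {f g : M ⟶ N}
    (h : ∀ (U : S.X.Opens) (x : msec M U), mapp f U x = mapp g U x) : f = g := by
  refine SheafOfModules.hom_ext (PresheafOfModules.hom_ext fun U => ?_)
  ext x
  exact h U.unop x

end

section

variable {G : Type v} [Group G] [TopologicalSpace G] {S : GScheme.{v, u} G}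

/-! ### The twisted Teichmüller lift of a line bundle -/

namespace CoeffSystem

variable (C : CoeffSystem S)

/-- The restriction maps. -/
abbrev restrict {U V : S.X.Opens} (h : V ≤ U) : C.T U →+* C.T V :=
  C.act 1 U V (S.le_translate_one h)

theorem restrict_act (g : G) {U V W : S.X.Opens} (h : V ≤ S.translate g U) (h' : W ≤ V)
    (x : C.T U) : C.restrict h' (C.act g U V h x) = C.act g U W (h'.trans h) x := by
  rw [restrict, ← C.act_mul 1 g U V W h _ (S.le_translate_mul h (S.le_translate_one h'))]
  exact act_congr (one_mul g) _ _ _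

theorem act_restrict (g : G) {U V W : S.X.Opens} (h : W ≤ S.translate g V) (h' : V ≤ U)
    (x : C.T U) : C.act g V W h (C.restrict h' x) =
      C.act g U W (h.trans (S.translate_mono g h')) x := by
  rw [restrict, ← C.act_mul g 1 U V W _ h (S.le_translate_mul (S.le_translate_one h') h)]
  exact act_congr (mul_one g) _ _ _

theorem restrict_restrict {U V W : S.X.Opens} (h : V ≤ U) (h' : W ≤ V) (x : C.T U) :
    C.restrict h' (C.restrict h x) = C.restrict (h'.trans h) x :=
  C.restrict_act 1 _ h' x

end CoeffSystem

section

variable {p : ℕ} [Fact p.Prime] {𝓡 : GRing S} {L : GModule 𝓡}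

/-- The restriction of a generator. -/
abbrev Gen.restrict {U V : S.X.Opens} (h : V ≤ U) (s : Gen L U) : Gen L V :=
  s.act 1 (S.le_translate_one h)

theorem Gen.restrict_val {U V : S.X.Opens} (h : V ≤ U) (s : Gen L U) :
    (s.restrict h).1 = res L.M h s.1 := L.act_one U V h _ s.1

theorem Gen.restrict_restrict {U V W : S.X.Opens} (h : V ≤ U) (h' : W ≤ V) (s : Gen L U) :
    (s.restrict h).restrict h' = s.restrict (h'.trans h) := by
  rw [Gen.restrict, Gen.act_act]
  exact Gen.act_congr (mul_one 1) _ _ _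

theorem Gen.restrict_of_smul {U V : S.X.Opens} (h : V ≤ U) {s t : Gen L U} {r : 𝓡.sec U}
    (hst : t.1 = r • s.1) :
    (t.restrict h).1 = 𝓡.act 1 U V (S.le_translate_one h) r • (s.restrict h).1 := by
  change L.act 1 U V _ t.1 = _
  rw [hst, map_smulₛₗ]
  rfl

theorem Gen.coef_restrict {U V : S.X.Opens} (h : V ≤ U) (s : Gen L U) (x : msec L.M U) :
    (s.restrict h).coef (res L.M h x) = 𝓡.act 1 U V (S.le_translate_one h) (s.coef x) := by
  rw [← Gen.coef_act, L.act_one U V h]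

theorem act_teichScale (g : G) {U V : S.X.Opens} (h : V ≤ S.translate g U) (r : 𝓡.sec U)
    (x : (wittCoeff p 𝓡).T U) : (wittCoeff p 𝓡).act g U V h (teichScale p 𝓡 U r x) =
      teichScale p 𝓡 V (𝓡.act g U V h r) ((wittCoeff p 𝓡).act g U V h x) :=
  (map_mul (W₂map p (𝓡.act g U V h)) _ _).trans (congrArg (· * _) (W₂.map_teich _ _))

variable (p L) in
/-- The sections over `U` of the Teichmüller lift of the line bundle `L`. -/
def wittFamily (U : S.X.Opens) : AddSubgroup (Family L (wittCoeff p 𝓡) U) where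
  carrier := {w | IsHomogeneous (teichScale p 𝓡) w}
  zero_mem' := ⟨fun V W hV hW s => (map_zero _).symm, fun V hV s t r h =>
    (mul_zero (W₂.teich p r : W₂ p (𝓡.sec V))).symm⟩
  add_mem' := fun {x y} hx hy =>
    ⟨fun V W hV hW s => by
      simp only [Pi.add_apply]
      rw [map_add, hx.natural V W hV hW s, hy.natural V W hV hW s],
    fun V hV s t r h => by
      simp only [Pi.add_apply]
      rw [hx.homogeneous V hV s t r h, hy.homogeneous V hV s t r h]
      exact (mul_add (W₂.teich p r : W₂ p (𝓡.sec V)) _ _).symm⟩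
  neg_mem' := fun {x} hx =>
    ⟨fun V W hV hW s => by
      simp only [Pi.neg_apply]
      rw [map_neg, hx.natural V W hV hW s],
    fun V hV s t r h => by
      simp only [Pi.neg_apply]
      rw [hx.homogeneous V hV s t r h]
      exact (mul_neg (W₂.teich p r : W₂ p (𝓡.sec V)) _).symm⟩

namespace wittFamily

theorem ext {U : S.X.Opens} {w w' : wittFamily p L U}
    (h : ∀ (V : S.X.Opens) (hV : V ≤ U) (s : Gen L V), w.1 ⟨V, hV⟩ s = w'.1 ⟨V, hV⟩ s) :
    w = w' :=
  Subtype.ext <| funext fun V => funext fun s => h V.1 V.2 s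

/-- The product of a homogeneous family of degree zero and a section. -/
def mulOf {U : S.X.Opens} (f : Family L (wittCoeff p 𝓡) U) (hf : IsHomogeneous (fun _ _ x => x) f) :
    wittFamily p L U →+ wittFamily p L U where
  toFun w := ⟨f * w.1,
    fun V W hV hW s => by
      simp only [Pi.mul_apply]
      rw [map_mul, hf.natural V W hV hW s, w.2.natural V W hV hW s],
    fun V hV s t r h => by
      simp only [Pi.mul_apply]
      rw [hf.homogeneous V hV s t r h, w.2.homogeneous V hV s t r h]
      exact mul_left_comm (_ : W₂ p (𝓡.sec V)) _ _⟩
  map_zero' := Subtype.ext (mul_zero _)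
  map_add' x y := Subtype.ext (mul_add _ _ _)

/-- An element of `W₂(𝓡(U))`, as a constant family. -/
def const {U : S.X.Opens} (a : W₂ p (𝓡.sec U)) : Family L (wittCoeff p 𝓡) U := fun V _ =>
  (wittCoeff p 𝓡).restrict V.2 a

theorem isHomogeneous_const {U : S.X.Opens} (a : W₂ p (𝓡.sec U)) :
    IsHomogeneous (fun _ _ x => x) (const (L := L) a) where
  natural _ _ hV hW _ := ((wittCoeff p 𝓡).restrict_restrict hV hW a).symm
  homogeneous _ _ _ _ _ _ := rfl

instance (U : S.X.Opens) : Module (W₂ p (𝓡.sec U)) (wittFamily p L U) where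
  smul a w := mulOf (const a) (isHomogeneous_const a) w
  one_smul w := ext fun V hV s => by
    change (wittCoeff p 𝓡).restrict hV 1 * w.1 ⟨V, hV⟩ s = _
    rw [map_one, one_mul]
  mul_smul a b w := ext fun V hV s => by
    change (wittCoeff p 𝓡).restrict hV (a * b) * w.1 ⟨V, hV⟩ s =
      (wittCoeff p 𝓡).restrict hV a * ((wittCoeff p 𝓡).restrict hV b * w.1 ⟨V, hV⟩ s)
    exact (congrArg (· * w.1 ⟨V, hV⟩ s) (map_mul ((wittCoeff p 𝓡).restrict hV) a b)).trans
      (mul_assoc _ _ _)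
  smul_zero a := map_zero _
  smul_add a x y := map_add _ _ _
  add_smul a b w := ext fun V hV s => by
    change (wittCoeff p 𝓡).restrict hV (a + b) * w.1 ⟨V, hV⟩ s =
      (wittCoeff p 𝓡).restrict hV a * w.1 ⟨V, hV⟩ s + (wittCoeff p 𝓡).restrict hV b * w.1 ⟨V, hV⟩ s
    exact (congrArg (· * w.1 ⟨V, hV⟩ s) (map_add ((wittCoeff p 𝓡).restrict hV) a b)).trans
      (add_mul _ _ _)
  zero_smul w := ext fun V hV s => by
    change (wittCoeff p 𝓡).restrict hV 0 * w.1 ⟨V, hV⟩ s = 0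
    rw [map_zero, zero_mul]

theorem smul_apply {U : S.X.Opens} (a : W₂ p (𝓡.sec U)) (w : wittFamily p L U)
    {V : S.X.Opens} (hV : V ≤ U) (s : Gen L V) :
    (a • w).1 ⟨V, hV⟩ s = (wittCoeff p 𝓡).restrict hV a * w.1 ⟨V, hV⟩ s := rfl

/-- The restriction of a section. -/
def restrict {U V : S.X.Opens} (h : V ≤ U) : wittFamily p L U →+ wittFamily p L V where
  toFun w := ⟨fun W s => w.1 ⟨W.1, W.2.trans h⟩ s,
    fun W W' hW hW' s => w.2.natural W W' (hW.trans h) hW' s,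
    fun W hW s t r hst => w.2.homogeneous W (hW.trans h) s t r hst⟩
  map_zero' := rfl
  map_add' _ _ := rfl

theorem restrict_smul {U V : S.X.Opens} (h : V ≤ U) (a : W₂ p (𝓡.sec U)) (w : wittFamily p L U) :
    restrict h (a • w) = W₂map p (𝓡.act 1 U V (S.le_translate_one h)) a • restrict h w :=
  ext fun W hW s => congrArg (· * w.1 ⟨W, hW.trans h⟩ s)
    ((wittCoeff p 𝓡).restrict_restrict h hW a).symm

theorem apply_eq {U : S.X.Opens} (w : wittFamily p L U) {V : S.X.Opens} (hV : V ≤ U) (s t : Gen L V) :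
    w.1 ⟨V, hV⟩ s = teichScale p 𝓡 V (s.coef t.1) (w.1 ⟨V, hV⟩ t) :=
  w.2.homogeneous V hV s t _ (s.coef_smul t.1).symm

/-- If t = rs, then w(s) = [r]·w(t), so w(s)₀·s = w(t)₀·rs = w(t)₀·t. The local sections glued in
`exists_reduction` are therefore independent of the generator. -/
theorem red_smul_eq {U : S.X.Opens} (w : wittFamily p L U) {V : S.X.Opens} (hV : V ≤ U)
    (s t : Gen L V) : W₂red p (𝓡.sec V) (w.1 ⟨V, hV⟩ s) • s.1 =
      W₂red p (𝓡.sec V) (w.1 ⟨V, hV⟩ t) • t.1 := by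
  have h : W₂red p (𝓡.sec V) (w.1 ⟨V, hV⟩ s) = s.coef t.1 * W₂red p (𝓡.sec V) (w.1 ⟨V, hV⟩ t) :=
    (congrArg (W₂red p (𝓡.sec V)) (apply_eq w hV s t)).trans (W₂.red_teich_mul _ _)
  rw [h, mul_comm, mul_smul, s.coef_smul]

theorem res_red_smul {U : S.X.Opens} (w : wittFamily p L U) {V W : S.X.Opens} (hV : V ≤ U)
    (hW : W ≤ V) (s : Gen L V) : res L.M hW (W₂red p (𝓡.sec V) (w.1 ⟨V, hV⟩ s) • s.1) =
      W₂red p (𝓡.sec W) (w.1 ⟨W, hW.trans hV⟩ (s.restrict hW)) • (s.restrict hW).1 := by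
  rw [w.2.natural V W hV hW s]
  refine Eq.trans ?_ (congrArg (· • (s.restrict hW).1) (W₂.red_map _ _).symm)
  rw [← L.act_one V W hW (S.le_translate_one hW), map_smulₛₗ]
  rfl

end wittFamily

/-! ### Reduction and local bases of the Teichmüller lift. -/

variable (L) in
/-- The module `L` has generators locally. -/
def HasGenerators : Prop := ∀ x : S.X, ∃ U : S.X.Opens, x ∈ U ∧ Nonempty (Gen L U)

theorem HasGenerators.le_iSup (hL : HasGenerators L) (U : S.X.Opens) :
    U ≤ ⨆ V : {V : S.X.Opens // V ≤ U ∧ Nonempty (Gen L V)}, V.1 := by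
  intro x hx
  obtain ⟨V, hxV, ⟨s⟩⟩ := hL x
  exact Opens.mem_iSup.2 ⟨⟨U ⊓ V, inf_le_left, ⟨s.restrict inf_le_right⟩⟩, hx, hxV⟩

theorem HasGenerators.section_ext (hL : HasGenerators L) {U : S.X.Opens} {x y : msec L.M U}
    (h : ∀ (V : S.X.Opens) (hV : V ≤ U), Gen L V → res L.M hV x = res L.M hV y) : x = y :=
  (msec_hasGluing L.M _ (fun V : {V : S.X.Opens // V ≤ U ∧ Nonempty (Gen L V)} => V.1) U
    (fun V => V.2.1) (hL.le_iSup U) (fun V => res L.M V.2.1 y) fun V W => by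
      simp only [res_res]).unique (fun V => h V.1 V.2.1 V.2.2.some) fun _ => rfl

namespace wittFamily

theorem exists_reduction (hL : HasGenerators L) {U : S.X.Opens} (w : wittFamily p L U) :
    ∃ x : msec L.M U, ∀ (V : S.X.Opens) (hV : V ≤ U) (s : Gen L V),
      res L.M hV x = W₂red p (𝓡.sec V) (w.1 ⟨V, hV⟩ s) • s.1 := by
  obtain ⟨x, hx, -⟩ := msec_hasGluing L.M _
    (fun V : {V : S.X.Opens // V ≤ U ∧ Nonempty (Gen L V)} => V.1) U
    (fun V => V.2.1) (hL.le_iSup U)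
    (fun V => W₂red p (𝓡.sec V.1) (w.1 ⟨V.1, V.2.1⟩ V.2.2.some) • V.2.2.some.1) fun V W =>
      (res_red_smul w V.2.1 inf_le_left _).trans
        ((red_smul_eq w _ _ _).trans (res_red_smul w W.2.1 inf_le_right _).symm)
  exact ⟨x, fun V hV s => (hx ⟨V, hV, ⟨s⟩⟩).trans (red_smul_eq w _ _ _)⟩

/-- The reduction map from the Teichmüller lift of `L` to `L`. -/
def reduction (hL : HasGenerators L) (U : S.X.Opens) :
    wittFamily p L U →ₛₗ[W₂red p (𝓡.sec U)] msec L.M U where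
  toFun w := (exists_reduction hL w).choose
  map_add' x y := hL.section_ext fun V hV s => by
    rw [map_add, (exists_reduction hL _).choose_spec V hV s,
      (exists_reduction hL _).choose_spec V hV s, (exists_reduction hL _).choose_spec V hV s,
      ← add_smul]
    exact congrArg (· • s.1) (map_add (W₂red p (𝓡.sec V)) _ _)
  map_smul' a x := hL.section_ext fun V hV s => by
    rw [← L.act_one U V hV (S.le_translate_one hV) (_ • _), map_smulₛₗ, L.act_one U V hV,
      (exists_reduction hL _).choose_spec V hV s, (exists_reduction hL _).choose_spec V hV s,
      smul_smul]
    congr 1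
    refine (map_mul (W₂red p (𝓡.sec V)) _ _).trans ?_
    exact congrArg (· * _) (W₂.red_map _ _)

theorem res_reduction (hL : HasGenerators L) {U V : S.X.Opens} (w : wittFamily p L U) (hV : V ≤ U)
    (s : Gen L V) : res L.M hV (reduction hL U w) = W₂red p (𝓡.sec V) (w.1 ⟨V, hV⟩ s) • s.1 :=
  (exists_reduction hL w).choose_spec V hV s

theorem reduction_eq (hL : HasGenerators L) {U : S.X.Opens} {w : wittFamily p L U} {x : msec L.M U}
    (h : ∀ (V : S.X.Opens) (hV : V ≤ U) (s : Gen L V),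
      W₂red p (𝓡.sec V) (w.1 ⟨V, hV⟩ s) = s.coef (res L.M hV x)) : reduction hL U w = x :=
  hL.section_ext fun V hV s => by
    rw [res_reduction hL w hV s, h, s.coef_smul]

theorem reduction_restrict (hL : HasGenerators L) {U V : S.X.Opens} (h : V ≤ U)
    (w : wittFamily p L U) : reduction hL V (restrict h w) = res L.M h (reduction hL U w) :=
  hL.section_ext fun W hW s => by
    rw [res_reduction hL _ hW s, res_res, res_reduction hL w (hW.trans h) s]
    rfl

/-- The section of the Teichmüller lift defined by a generator. -/
def ofGen {U : S.X.Opens} (s₀ : Gen L U) : wittFamily p L U :=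
  ⟨fun V s => (W₂.teich p (s.coef (s₀.restrict V.2).1) : W₂ p (𝓡.sec V.1)),
    fun V W hV hW s => by
      refine Eq.trans ?_ (W₂.map_teich _ _).symm
      rw [← Gen.coef_restrict hW, ← Gen.restrict_val, Gen.restrict_restrict],
    fun V hV s t r hst => by
      refine Eq.trans ?_ (map_mul (W₂.teich p) _ _)
      congr 1
      refine s.coef_eq ?_
      rw [mul_comm, mul_smul, ← hst, t.coef_smul]⟩

/-- The inverse is evaluation at the restriction of `s₀`: there `ofGen s₀` has the value [1] = 1,
and a homogeneous family is determined by its value at one generator. -/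
theorem bijective_smul_ofGen {U V : S.X.Opens} (h : V ≤ U) (s₀ : Gen L U) :
    Function.Bijective fun a : W₂ p (𝓡.sec V) => a • restrict h (ofGen (p := p) s₀) := by
  have h1 : (ofGen (p := p) s₀).1 ⟨V, h⟩ (s₀.restrict h) = 1 := by
    refine Eq.trans ?_ (map_one (W₂.teich p))
    exact congrArg (W₂.teich p) (Gen.coef_eq _ (one_smul _ _))
  have h2 (a : W₂ p (𝓡.sec V)) :
      (a • restrict h (ofGen (p := p) s₀)).1 ⟨V, le_rfl⟩ (s₀.restrict h) = a := by
    rw [smul_apply]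
    refine (congrArg (_ * ·) h1).trans ?_
    rw [mul_one]
    exact (wittCoeff p 𝓡).act_self V _ a
  constructor
  · intro a b hab
    rw [← h2 a, ← h2 b]
    exact congrArg (fun w : wittFamily p L V => w.1 ⟨V, le_rfl⟩ (s₀.restrict h)) hab
  · intro w
    refine ⟨w.1 ⟨V, le_rfl⟩ (s₀.restrict h), ext fun W hW s => ?_⟩
    rw [apply_eq w hW s (s₀.restrict (hW.trans h)), ← Gen.restrict_restrict h hW,
      w.2.natural V W le_rfl hW]
    refine (mul_comm (_ : W₂ p (𝓡.sec W)) _).trans ?_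
    rw [Gen.restrict_restrict]
    rfl

/-- The value at a generator s over W is glued from the values of the given families over the opens
W ∩ U i. Uniqueness of this gluing in W₂(𝓡) yields naturality, homogeneity and uniqueness of the
glued family. -/
theorem hasGluing (h𝓡 : HasGluing (fun V : S.X.Opens => W₂ p (𝓡.sec V))
    (fun h x => (wittCoeff p 𝓡).restrict h x)) :
    HasGluing (fun U => wittFamily p L U) (fun h x => restrict h x) := by
  intro ι U V hU hV w hw
  have hw' (i j : ι) (W : S.X.Opens) (hi : W ≤ U i) (hj : W ≤ U j) (s : Gen L W) :
      (w i).1 ⟨W, hi⟩ s = (w j).1 ⟨W, hj⟩ s :=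
    congrArg (fun z : wittFamily p L (U i ⊓ U j) => z.1 ⟨W, le_inf hi hj⟩ s) (hw i j)
  have key (W : S.X.Opens) (hW : W ≤ V) (s : Gen L W) : ∃! t : (wittCoeff p 𝓡).T W,
      ∀ i, (wittCoeff p 𝓡).restrict (inf_le_left : W ⊓ U i ≤ W) t =
        (w i).1 ⟨W ⊓ U i, inf_le_right⟩ (s.restrict inf_le_left) := by
    refine h𝓡 ι (fun i => W ⊓ U i) W (fun i => inf_le_left) ?_ _ fun i j => ?_
    · intro x hx
      obtain ⟨i, hi⟩ := Opens.mem_iSup.1 (hV (hW hx))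
      exact Opens.mem_iSup.2 ⟨i, hx, hi⟩
    · refine ((w i).2.natural _ _ inf_le_right inf_le_left _).symm.trans
        (Eq.trans ?_ ((w j).2.natural _ _ inf_le_right inf_le_right _))
      exact (congrArg _ (Gen.restrict_restrict inf_le_left inf_le_left s)).trans
        ((hw' i j _ _ _ _).trans
          (congrArg _ (Gen.restrict_restrict inf_le_left inf_le_right s).symm))
  choose f hf huniq using key
  refine ⟨⟨fun W s => f W.1 W.2 s, ?_, ?_⟩, ?_, ?_⟩
  · intro W W' hW hW' s
    refine (huniq W' (hW'.trans hW) _ _ fun i => ?_).symm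
    have h1 : W' ⊓ U i ≤ W ⊓ U i := inf_le_inf_right _ hW'
    refine ((wittCoeff p 𝓡).restrict_restrict hW' inf_le_left _).trans ?_
    refine ((wittCoeff p 𝓡).restrict_restrict inf_le_left h1 _).symm.trans ?_
    refine (congrArg _ (hf W hW s i)).trans (((w i).2.natural _ _ inf_le_right h1 _).symm.trans ?_)
    exact congrArg _ ((Gen.restrict_restrict inf_le_left h1 s).trans
      (Gen.restrict_restrict hW' inf_le_left s).symm)
  · intro W hW s t r hst
    refine (huniq W hW _ _ fun i => ?_).symm
    refine Eq.trans ?_ ((w i).2.homogeneous _ inf_le_right _ _ _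
      (Gen.restrict_of_smul inf_le_left hst)).symm
    refine (act_teichScale 1 _ _ _).trans ?_
    exact congrArg (teichScale p 𝓡 _ _) (hf W hW t i)
  · intro i
    refine ext fun W hW s => (huniq W (hW.trans (hU i)) s _ fun j => ?_).symm
    exact ((w i).2.natural _ _ hW inf_le_left s).symm.trans (hw' i j _ _ _ _)
  · intro z hz
    refine ext fun W hW s => huniq W hW s _ fun i => ?_
    refine (z.2.natural _ _ hW inf_le_left s).symm.trans ?_
    exact congrArg (fun x : wittFamily p L (U i) => x.1 ⟨W ⊓ U i, inf_le_right⟩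
      (s.restrict inf_le_left)) (hz i)

theorem reduction_restrict_ofGen (hL : HasGenerators L) {U V : S.X.Opens} (h : V ≤ U)
    (s₀ : Gen L U) : reduction hL V (restrict h (ofGen (p := p) s₀)) = res L.M h s₀.1 :=
  reduction_eq hL fun W hW s => by
    refine (W₂.red_teich _).trans ?_
    rw [Gen.restrict_val, res_res]

end wittFamily

/-! ### Twisting the action on the Teichmüller lift by a cocycle. -/

variable (p L) in
/-- A cocycle of homogeneous families of degree zero, with values in `1 + VW₂`. -/
structure TwistCocycle where
  /-- the cocycle -/
  u : G → Family L (wittCoeff p 𝓡) ⊤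
  homogeneous (g : G) : IsHomogeneous (fun _ _ x => x) (u g)
  red_u (g : G) (V : {V : S.X.Opens // V ≤ ⊤}) (s : Gen L V.1) :
    W₂red p (𝓡.sec V.1) (u g V s) = 1
  u_mul (g h : G) : u (g * h) = u g * (u h).act (U' := ⊤) g le_rfl
  naive : ∃ N : OpenSubgroup G, ∀ g ∈ N, u g = 1

namespace TwistCocycle

variable (T : TwistCocycle p L)

theorem u_one : T.u 1 = 1 := by
  obtain ⟨N, hN⟩ := T.naive
  exact hN 1 (one_mem N)

/-- The twisted action on the Teichmüller lift of `L`. -/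
def act (g : G) {U V : S.X.Opens} (h : V ≤ S.translate g U) :
    wittFamily p L U →ₛₗ[W₂map p (𝓡.act g U V h)] wittFamily p L V where
  toFun w := wittFamily.mulOf (U := V) (fun W s => T.u g ⟨W.1, le_top⟩ s)
    ⟨fun W W' hW hW' s => (T.homogeneous g).natural W W' le_top hW' s,
      fun W hW s t r hst => (T.homogeneous g).homogeneous W le_top s t r hst⟩
    ⟨Family.act (C := wittCoeff p 𝓡) g h w.1, w.2.act (fun g _ _ h => act_teichScale g h) g h⟩
  map_add' x y := by
    rw [← map_add]
    exact congrArg _ (wittFamily.ext fun W hW s => map_add ((wittCoeff p 𝓡).act g _ _ _) _ _)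
  map_smul' a w := wittFamily.ext fun W hW s => by
    have hWU := S.translate_inv_le (hW.trans h)
    have h1 := map_mul ((wittCoeff p 𝓡).act g _ W (S.le_translate_inv g W))
      ((wittCoeff p 𝓡).restrict hWU a) (w.1 ⟨_, hWU⟩ (s.act g⁻¹ le_rfl))
    have h2 := ((wittCoeff p 𝓡).act_restrict g (S.le_translate_inv g W) hWU a).trans
      ((wittCoeff p 𝓡).restrict_act g h hW a).symm
    exact (congrArg (T.u g ⟨W, le_top⟩ s * ·) (h1.trans (congrArg (· * _) h2))).trans
      (mul_left_comm _ _ _)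

theorem act_apply (g : G) {U V : S.X.Opens} (h : V ≤ S.translate g U) (w : wittFamily p L U)
    {W : S.X.Opens} (hW : W ≤ V) (s : Gen L W) :
    (T.act g h w).1 ⟨W, hW⟩ s = T.u g ⟨W, le_top⟩ s * Family.act (C := wittCoeff p 𝓡) g h w.1 ⟨W, hW⟩ s := rfl

theorem act_of_trivial {g : G} (hu : T.u g = 1) {U V : S.X.Opens} (h : V ≤ S.translate g U)
    (hVU : V ≤ U) (hg : ∀ W : S.X.Opens, W ≤ S.translate g W)
    (h𝓡 : ∀ (W : S.X.Opens) (a : 𝓡.sec W), 𝓡.act g W W (hg W) a = a)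
    (hL : ∀ (W : S.X.Opens) (x : msec L.M W), L.act g W W (hg W) x = x) (w : wittFamily p L U) :
    T.act g h w = wittFamily.restrict hVU w :=
  wittFamily.ext fun W hW s => by
    rw [act_apply, hu]
    refine (one_mul _).trans (w.2.act_of_trivial h hVU hW (hg W) (hL W) (fun a => ?_) s)
    have : 𝓡.act g W W (hg W) = RingHom.id _ := RingHom.ext (h𝓡 W)
    exact (congrArg (fun f => W₂map p f a) this).trans (W₂.map_id a)

theorem act_one {U V : S.X.Opens} (h : V ≤ S.translate 1 U) (hVU : V ≤ U) (w : wittFamily p L U) :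
    T.act 1 h w = wittFamily.restrict hVU w :=
  T.act_of_trivial T.u_one h hVU (fun _ => S.le_translate_one le_rfl)
    (fun _ => GRing.act_self _) (fun W x => (L.act_one W W le_rfl _ x).trans (res_self _ _ _)) w

theorem act_mul (g h : G) {U V W : S.X.Opens} (h₁ : V ≤ S.translate h U) (h₂ : W ≤ S.translate g V)
    (h₃ : W ≤ S.translate (g * h) U) (w : wittFamily p L U) :
    T.act (g * h) h₃ w = T.act g h₂ (T.act h h₁ w) :=
  wittFamily.ext fun Y hY s => by
    rw [act_apply, act_apply, T.u_mul g h, ← w.2.act_act g h h₁ h₂]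
    refine (mul_assoc _ _ _).trans (congrArg (T.u g ⟨Y, le_top⟩ s * ·) ?_)
    exact (map_mul ((wittCoeff p 𝓡).act g _ Y (S.le_translate_inv g Y)) _ _).symm

/-- The twist takes values congruent to 1, so it is invisible after reduction. -/
theorem reduction_act (hL : HasGenerators L) (g : G) {U V : S.X.Opens} (h : V ≤ S.translate g U)
    (w : wittFamily p L U) : wittFamily.reduction hL V (T.act g h w) =
      L.act g U V h (wittFamily.reduction hL U w) :=
  wittFamily.reduction_eq hL fun W hW s => by
    have hWU : S.translate g⁻¹ W ≤ U := S.translate_inv_le (hW.trans h)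
    have h1 : W₂red p (𝓡.sec W) ((T.act g h w).1 ⟨W, hW⟩ s) =
        𝓡.act g _ W (S.le_translate_inv g W) (W₂red p (𝓡.sec _) (w.1 ⟨_, hWU⟩ (s.act g⁻¹ le_rfl))) := by
      refine (map_mul (W₂red p (𝓡.sec W)) (T.u g ⟨W, le_top⟩ s) _).trans ?_
      refine (congrArg (· * _) (T.red_u g ⟨W, le_top⟩ s)).trans ((one_mul _).trans ?_)
      exact W₂.red_map _ _
    have h2 : s = (s.act g⁻¹ le_rfl).act g (S.le_translate_inv g W) := (Gen.act_inv_act g _ _ s).symm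
    rw [h1, GModule.res_act, ← GModule.act_res g (S.le_translate_inv g W) hWU,
      wittFamily.res_reduction hL w hWU (s.act g⁻¹ le_rfl)]
    refine Eq.trans ?_ (congrArg (fun t : Gen L W => t.coef _) h2.symm)
    rw [Gen.coef_act, Gen.coef_eq _ rfl]

end TwistCocycle

end

end

section

variable {G : Type v} [Group G] [TopologicalSpace G] {S : GScheme.{v, u} G}

/-! ### Split extensions -/

section

variable {𝓡 : GRing S}

theorem mapp_res {M N : SheafOfModules.{u} 𝓡.ringSheaf} (f : M ⟶ N) {U V : S.X.Opens} (h : V ≤ U)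
    (x : msec M U) : mapp f V (res M h x) = res N h (mapp f U x) :=
  PresheafOfModules.naturality_apply f.val (homOfLE h).op x

theorem res_smul (M : SheafOfModules.{u} 𝓡.ringSheaf) {U V : S.X.Opens} (h : V ≤ U)
    (a : 𝓡.sec U) (x : msec M U) :
    res M h (a • x) = (𝓡.R.obj.map (homOfLE h).op a : 𝓡.sec V) • res M h x :=
  PresheafOfModules.map_smul M.val (homOfLE h).op a x

/-- A morphism from `𝓡`, on sections over `U`. -/
def unitHom {M : SheafOfModules.{u} 𝓡.ringSheaf} (s : SheafOfModules.unit 𝓡.ringSheaf ⟶ M)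
    (U : S.X.Opens) : 𝓡.sec U →ₗ[𝓡.sec U] msec M U where
  toFun a := mapp s U a
  map_add' a b := (mapp s U).map_add a b
  map_smul' a b := (mapp s U).map_smul a b

/-- A morphism to `𝓡`, on sections over `U`. -/
def homUnit {M : SheafOfModules.{u} 𝓡.ringSheaf} (q : M ⟶ SheafOfModules.unit 𝓡.ringSheaf)
    (U : S.X.Opens) : msec M U →ₗ[𝓡.sec U] 𝓡.sec U where
  toFun x := mapp q U x
  map_add' a b := (mapp q U).map_add a b
  map_smul' a b := (mapp q U).map_smul a b

theorem smul_unitHom_one {M : SheafOfModules.{u} 𝓡.ringSheaf}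
    (s : SheafOfModules.unit 𝓡.ringSheaf ⟶ M) (U : S.X.Opens) (a : 𝓡.sec U) :
    a • unitHom s U 1 = unitHom s U a := by
  rw [← map_smul, smul_eq_mul, mul_one]

theorem unitHom_apply {M : SheafOfModules.{u} 𝓡.ringSheaf}
    (s : SheafOfModules.unit 𝓡.ringSheaf ⟶ M) {U V : S.X.Opens} (h : V ≤ U) (a : 𝓡.sec V) :
    unitHom s V a = a • res M h (unitHom s U 1) := by
  have h1 : unitHom s V 1 = res M h (unitHom s U 1) :=
    (congrArg (unitHom s V) (map_one (𝓡.R.obj.map (homOfLE h).op).hom)).symm.trans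
      (mapp_res s h (1 : 𝓡.sec U))
  rw [← h1, smul_unitHom_one]

theorem GScheme.top_le_translate (S : GScheme.{v, u} G) (g : G) :
    ⊤ ≤ S.translate g ⊤ := le_rfl

theorem GRing.hasGluing (𝓡 : GRing S) :
    HasGluing 𝓡.sec (fun h x => 𝓡.R.obj.map (homOfLE h).op x) := by
  intro ι U V hU hV s hs
  obtain rfl : V = iSup U := le_antisymm hV (iSup_le hU)
  exact TopCat.Presheaf.IsSheaf.isSheafUniqueGluing 𝓡.R.property U s hs

theorem GRing.map_map (𝓡 : GRing S) {U V W : S.X.Opens} (h : V ≤ U) (h' : W ≤ V) (a : 𝓡.sec U) :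
    𝓡.R.obj.map (homOfLE h').op (𝓡.R.obj.map (homOfLE h).op a) =
      𝓡.R.obj.map (homOfLE (h'.trans h)).op a :=
  congrArg (fun f => f.hom a) (𝓡.R.obj.map_comp (homOfLE h).op (homOfLE h').op).symm

theorem GRing.map_self (𝓡 : GRing S) {U : S.X.Opens} (h : U ≤ U) (a : 𝓡.sec U) :
    𝓡.R.obj.map (homOfLE h).op a = a :=
  congrArg (fun f => f.hom a) (𝓡.R.obj.map_id (op U))

theorem GRing.map_act (𝓡 : GRing S) (g : G) {U V W : S.X.Opens} (h : V ≤ S.translate g U)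
    (h' : W ≤ V) (a : 𝓡.sec U) :
    𝓡.R.obj.map (homOfLE h').op (𝓡.act g U V h a) = 𝓡.act g U W (h'.trans h) a := by
  rw [← 𝓡.act_one V W h' (S.le_translate_one h'), ← 𝓡.act_mul 1 g U V W h _
    (S.le_translate_mul h (S.le_translate_one h'))]
  have key : ∀ (k : G) (_ : k = g) (h2 : W ≤ S.translate k U),
      𝓡.act k U W h2 a = 𝓡.act g U W (h'.trans h) a := by
    rintro k rfl h2
    rfl
  exact key _ (one_mul g) _

/-! ### Retraction, local basis and cocycle of a split extension. -/

namespace GExtension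

variable {L : GModule 𝓡} (𝓔 : GExtension L)
  {s : SheafOfModules.unit 𝓡.ringSheaf ⟶ 𝓔.E.M} (hs : s ≫ 𝓔.q = 𝟙 _)

theorem q_ι (U : S.X.Opens) (x : msec L.M U) : homUnit 𝓔.q U (mapp 𝓔.ι U x) = 0 :=
  congrArg (fun f => mapp f U x) 𝓔.zero

include hs in
theorem q_section (U : S.X.Opens) (a : 𝓡.sec U) : homUnit 𝓔.q U (unitHom s U a) = a :=
  congrArg (fun f => mapp f U a) hs

include hs in
theorem exists_retraction : ∃ r : 𝓔.E.M ⟶ L.M,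
    (∀ (U : S.X.Opens) (x : msec L.M U), mapp r U (mapp 𝓔.ι U x) = x) ∧
    ∀ (U : S.X.Opens) (y : msec 𝓔.E.M U), mapp 𝓔.ι U (mapp r U y) + unitHom s U (homUnit 𝓔.q U y) = y := by
  let σ := ShortComplex.Splitting.ofExactOfSection _ 𝓔.exact.exact s hs 𝓔.exact.mono_f
  refine ⟨σ.r, fun U x => ?_, fun U y => ?_⟩
  · exact congrArg (fun f => mapp f U x) σ.f_r
  · exact congrArg (fun f => mapp f U y) σ.id

include hs in
theorem bijective_ι_add_section (U : S.X.Opens) :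
    Function.Bijective fun x : msec L.M U × 𝓡.sec U => mapp 𝓔.ι U x.1 + unitHom s U x.2 := by
  obtain ⟨r, hr, hr'⟩ := 𝓔.exists_retraction hs
  constructor
  · rintro ⟨x, a⟩ ⟨y, b⟩ h
    have h1 := congrArg (homUnit 𝓔.q U) h
    simp only [map_add, q_ι, zero_add, 𝓔.q_section hs] at h1
    subst h1
    have h2 := congrArg (mapp r U) (add_right_cancel h)
    rw [hr, hr] at h2
    exact congrArg (·, a) h2
  · intro y
    exact ⟨(mapp r U y, homUnit 𝓔.q U y), hr' U y⟩

include hs in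
theorem bijective_sum_smul {U : S.X.Opens} {x : msec L.M U}
    (hx : Function.Bijective fun a : 𝓡.sec U => a • x) :
    Function.Bijective fun a : Fin 2 → 𝓡.sec U =>
      ∑ i, a i • (![mapp 𝓔.ι U x, unitHom s U 1] : Fin 2 → msec 𝓔.E.M U) i := by
  have h1 := ((𝓔.bijective_ι_add_section hs U).comp (hx.prodMap Function.bijective_id)).comp
    (piFinTwoEquiv fun _ => 𝓡.sec U).bijective
  convert h1 using 2 with a
  rw [Fin.sum_univ_two]
  simp only [Function.comp_apply, piFinTwoEquiv_apply, Prod.map, map_smul, id, Matrix.cons_val_zero,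
    Matrix.cons_val_one]
  exact congrArg (_ + ·) (smul_unitHom_one s U (a 1))

theorem q_act (g : G) {U V : S.X.Opens} (h : V ≤ S.translate g U) (y : msec 𝓔.E.M U) :
    homUnit 𝓔.q V (𝓔.E.act g U V h y) = 𝓡.act g U V h (homUnit 𝓔.q U y) :=
  𝓔.q_equivariant g U V h y

-- Equivariance of q and invariance of 1 show that g·s(1) - s(1) is killed by q, so it comes from a
-- global section c(g) of L. An open subgroup acting trivially on E makes c vanish on it.
include hs in
theorem exists_cocycle : ∃ c : G → msec L.M ⊤,
    (∀ g, 𝓔.E.act g ⊤ ⊤ (S.top_le_translate g) (unitHom s ⊤ 1) =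
      mapp 𝓔.ι ⊤ (c g) + unitHom s ⊤ 1) ∧
    (∀ g h, c (g * h) = c g + L.act g ⊤ ⊤ (S.top_le_translate g) (c h)) ∧
    ∃ N : OpenSubgroup G, ∀ g ∈ N, c g = 0 := by
  obtain ⟨r, hr, hr'⟩ := 𝓔.exists_retraction hs
  have key (g : G) : 𝓔.E.act g ⊤ ⊤ (S.top_le_translate g) (unitHom s ⊤ 1) =
      mapp 𝓔.ι ⊤ (mapp r ⊤ (𝓔.E.act g ⊤ ⊤ (S.top_le_translate g) (unitHom s ⊤ 1))) +
        unitHom s ⊤ 1 := by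
    conv_lhs => rw [← hr' ⊤ (𝓔.E.act g ⊤ ⊤ (S.top_le_translate g) (unitHom s ⊤ 1)), 𝓔.q_act,
      𝓔.q_section hs, map_one (𝓡.act _ _ _ _)]
  have hinj : Function.Injective (mapp 𝓔.ι ⊤) := fun x y h => by
    rw [← hr ⊤ x, h, hr]
  refine ⟨_, key, fun g h => hinj (add_right_cancel (b := unitHom s ⊤ 1) ?_), ?_⟩
  · rw [← key, 𝓔.E.act_mul g h ⊤ ⊤ ⊤ (S.top_le_translate h) (S.top_le_translate g)]
    conv_lhs => rw [key h, map_add, key g]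
    rw [map_add, 𝓔.ι_equivariant]
    abel
  · obtain ⟨N, hN⟩ := 𝓔.E.naive
    refine ⟨N, fun g hg => hinj (add_right_cancel (b := unitHom s ⊤ 1) ?_)⟩
    rw [← key, hN g hg ⊤ ⊤ le_rfl, res_self, map_zero, zero_add]

/-- As s(a) = a·s(1) with s(1) global, the one global section c describes the action on s over every
open. -/
theorem act_section {g : G} {c : msec L.M ⊤}
    (hc : 𝓔.E.act g ⊤ ⊤ (S.top_le_translate g) (unitHom s ⊤ 1) = mapp 𝓔.ι ⊤ c + unitHom s ⊤ 1)
    {U V : S.X.Opens} (h : V ≤ S.translate g U) (a : 𝓡.sec U) :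
    𝓔.E.act g U V h (unitHom s U a) =
      mapp 𝓔.ι V (𝓡.act g U V h a • res L.M le_top c) + unitHom s V (𝓡.act g U V h a) := by
  rw [unitHom_apply s (le_top : U ≤ ⊤) a, map_smulₛₗ, GModule.act_res,
    ← GModule.res_act (L := 𝓔.E) g (S.top_le_translate g) le_top, hc, map_add, smul_add,
    ← unitHom_apply, map_smul, mapp_res]

end GExtension

end

end

section

variable {G : Type v} [Group G] [TopologicalSpace G] {S : GScheme.{v, u} G}

/-! ### The extension defined by a cocycle -/

theorem GRing.IsNaive.exists_act_eq {𝓡 : GRing S} (h𝓡 : 𝓡.IsNaive) :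
    ∃ N : OpenSubgroup G, ∀ g ∈ N, ∀ (U V : S.X.Opens) (hVU : V ≤ U) (h : V ≤ S.translate g U)
      (a : 𝓡.sec U), 𝓡.act g U V h a = 𝓡.R.obj.map (homOfLE hVU).op a := by
  obtain ⟨N, hN⟩ := h𝓡
  refine ⟨N, fun g hg U V hVU h a => ?_⟩
  have hU : U ≤ S.translate g U := (S.translate_of_eq_one (hN g hg).1 U).ge
  rw [← 𝓡.map_act g hU hVU, (hN g hg).2]

namespace GExtension

section

variable {𝓡 : GRing S} (L : GModule 𝓡)

/-- The sheaf of modules `L × 𝓡`. -/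
def prodData : ModuleData 𝓡 where
  F U := msec L.M U × 𝓡.sec U
  r h := (res L.M h).prodMap (𝓡.R.obj.map (homOfLE h).op).hom.toAddMonoidHom
  r_self h _ := Prod.ext (res_self _ _ _) (𝓡.map_self h _)
  r_r h h' _ := Prod.ext (res_res _ _ _ _) (𝓡.map_map h h' _)
  r_smul h _ _ := Prod.ext (res_smul _ _ _ _) (map_mul (𝓡.R.obj.map (homOfLE h).op).hom _ _)
  gluing := (msec_hasGluing L.M).prod 𝓡.hasGluing

/-- The action on `L × 𝓡` defined by a cocycle. -/
def prodAct (w : G → msec L.M ⊤) (g : G) {U V : S.X.Opens} (h : V ≤ S.translate g U) :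
    (msec L.M U × 𝓡.sec U) →ₛₗ[𝓡.act g U V h] (msec L.M V × 𝓡.sec V) where
  toFun x := (L.act g U V h x.1 + 𝓡.act g U V h x.2 • res L.M le_top (w g), 𝓡.act g U V h x.2)
  map_add' x y := by
    refine Prod.ext ?_ (map_add _ _ _)
    change L.act g U V h (x.1 + y.1) + 𝓡.act g U V h (x.2 + y.2) • _ =
      (L.act g U V h x.1 + 𝓡.act g U V h x.2 • res L.M le_top (w g)) +
        (L.act g U V h y.1 + 𝓡.act g U V h y.2 • res L.M le_top (w g))
    rw [map_add, map_add, add_smul]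
    abel
  map_smul' a x := by
    refine Prod.ext ?_ (map_mul _ _ _)
    change L.act g U V h (a • x.1) + 𝓡.act g U V h (a * x.2) • _ =
      𝓡.act g U V h a • (L.act g U V h x.1 + 𝓡.act g U V h x.2 • res L.M le_top (w g))
    rw [map_smulₛₗ, map_mul, smul_add, mul_smul]

variable {w : G → msec L.M ⊤}
  (hw : ∀ g h, w (g * h) = w g + L.act g ⊤ ⊤ (S.top_le_translate g) (w h))
  (hwN : ∃ N : OpenSubgroup G, ∀ g ∈ N, w g = 0)

include hw in
theorem prodAct_mul (g h : G) {U V W : S.X.Opens} (h₁ : V ≤ S.translate h U)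
    (h₂ : W ≤ S.translate g V) (h₃ : W ≤ S.translate (g * h) U) (x : msec L.M U × 𝓡.sec U) :
    prodAct L w (g * h) h₃ x = prodAct L w g h₂ (prodAct L w h h₁ x) := by
  refine Prod.ext ?_ (𝓡.act_mul g h U V W h₁ h₂ h₃ _)
  change L.act (g * h) U W h₃ x.1 + 𝓡.act (g * h) U W h₃ x.2 • res L.M le_top (w (g * h)) =
    L.act g V W h₂ (L.act h U V h₁ x.1 + 𝓡.act h U V h₁ x.2 • res L.M le_top (w h)) +
      𝓡.act g V W h₂ (𝓡.act h U V h₁ x.2) • res L.M le_top (w g)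
  rw [hw, L.act_mul g h U V W h₁ h₂, 𝓡.act_mul g h U V W h₁ h₂, map_add, map_add, map_smulₛₗ,
    GModule.act_res, GModule.res_act, smul_add]
  abel

/-- The module with `G`-action `L × 𝓡`, where the action is defined by a cocycle. -/
def prodModule (h𝓡 : 𝓡.IsNaive) : GModule 𝓡 where
  M := (prodData L).toSheafOfModules
  act g _ _ h := prodAct L w g h
  act_one U V hVU h x := by
    obtain ⟨N, hN⟩ := hwN
    refine Prod.ext ?_ (𝓡.act_one U V hVU h _)
    change L.act 1 U V h x.1 + 𝓡.act 1 U V h x.2 • res L.M le_top (w 1) = res L.M hVU x.1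
    rw [hN 1 (one_mem N), map_zero, smul_zero, add_zero, L.act_one U V hVU]
  act_mul g h _ _ _ h₁ h₂ h₃ x := prodAct_mul L hw g h h₁ h₂ h₃ x
  naive := by
    obtain ⟨N₁, hN₁⟩ := hwN
    obtain ⟨N₂, hN₂⟩ := h𝓡.exists_act_eq
    obtain ⟨N₃, hN₃⟩ := L.naive
    refine ⟨N₁ ⊓ N₂ ⊓ N₃, fun g hg U V hVU h x => ?_⟩
    refine Prod.ext ?_ (hN₂ g hg.1.2 U V hVU h _)
    change L.act g U V h x.1 + 𝓡.act g U V h x.2 • res L.M le_top (w g) = res L.M hVU x.1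
    rw [hN₁ g hg.1.1, map_zero, smul_zero, add_zero, hN₃ g hg.2 U V hVU]

/-- The inclusion of `L` in `L × 𝓡`. -/
def prodInl : L.M ⟶ (prodData L).toSheafOfModules :=
  homMk (fun U => LinearMap.inl (𝓡.sec U) (msec L.M U) (𝓡.sec U))
    fun {_ _} h _ => Prod.ext rfl (map_zero (𝓡.R.obj.map (homOfLE h).op).hom).symm

/-- The inclusion of `𝓡` in `L × 𝓡`. -/
def prodInr : SheafOfModules.unit 𝓡.ringSheaf ⟶ (prodData L).toSheafOfModules :=
  homMk (fun U => LinearMap.inr (𝓡.sec U) (msec L.M U) (𝓡.sec U))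
    fun {_ _} h _ => Prod.ext (map_zero (res L.M h)).symm rfl

/-- The projection from `L × 𝓡` to `L`. -/
def prodFst : (prodData L).toSheafOfModules ⟶ L.M :=
  homMk (fun U => LinearMap.fst (𝓡.sec U) (msec L.M U) (𝓡.sec U)) fun _ _ => rfl

/-- The projection from `L × 𝓡` to `𝓡`. -/
def prodSnd : (prodData L).toSheafOfModules ⟶ SheafOfModules.unit 𝓡.ringSheaf :=
  homMk (fun U => LinearMap.snd (𝓡.sec U) (msec L.M U) (𝓡.sec U)) fun _ _ => rfl

theorem prodInr_prodSnd : prodInr L ≫ prodSnd L = 𝟙 _ := sheafHom_ext fun _ _ => rfl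

/-- The extension of `𝓡` by `L` defined by a cocycle. -/
def ofCocycle (h𝓡 : 𝓡.IsNaive) : GExtension L where
  E := prodModule L hw hwN h𝓡
  ι := prodInl L
  q := prodSnd L
  ι_equivariant g U V h x := by
    refine Prod.ext ?_ (map_zero (𝓡.act g U V h)).symm
    change L.act g U V h x = L.act g U V h x + 𝓡.act g U V h 0 • res L.M le_top (w g)
    rw [map_zero, zero_smul, add_zero]
  q_equivariant _ _ _ _ _ := rfl
  zero := sheafHom_ext fun _ _ => rfl
  exact := ShortComplex.Splitting.shortExact
    { r := prodFst L
      s := prodInr L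
      f_r := sheafHom_ext fun _ _ => rfl
      s_g := prodInr_prodSnd L
      id := sheafHom_ext fun _ x => Prod.ext (add_zero x.1) (zero_add x.2) }

end

end GExtension

end

section

variable {G : Type v} [Group G] [TopologicalSpace G] {S : GScheme.{v, u} G}

/-! ### The Teichmüller lift of a line bundle -/

theorem isNaive_structureSheaf (S : GScheme.{v, u} G) : (structureSheaf S).IsNaive := by
  obtain ⟨N, hN⟩ := S.naive
  refine ⟨N, fun g hg => ⟨hN g hg, fun U h a => ?_⟩⟩
  have key (k : G) (hk : S.ρ k = S.ρ 1) (h : U ≤ S.translate k U) :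
      (structureSheaf S).act k U U h a = a := by
    have h1 : (structureSheaf S).act k U U h a =
        (structureSheaf S).act 1 U U (S.le_translate_one le_rfl) a := by
      change ((S.ρ k).inv.appLE U U h).hom a = ((S.ρ 1).inv.appLE U U _).hom a
      simp only [hk]
    rw [h1, GRing.act_self]
  exact key g ((hN g hg).trans (map_one _).symm) h

theorem isNaive_wittSheaf (p : ℕ) [Fact p.Prime] (S : GScheme.{v, u} G) :
    (wittSheaf p S).IsNaive := by
  obtain ⟨N, hN⟩ := isNaive_structureSheaf S
  refine ⟨N, fun g hg => ⟨(hN g hg).1, fun U h a => ?_⟩⟩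
  have h1 : (structureSheaf S).act g U U h = RingHom.id _ := RingHom.ext ((hN g hg).2 U h)
  exact (congrArg (fun f => W₂map p f a) h1).trans (W₂.map_id a)

theorem bijective_sum_fin_one {R M : Type*} [Semiring R] [AddCommMonoid M] [Module R M]
    {e : Fin 1 → M} : (Function.Bijective fun a : Fin 1 → R => ∑ i, a i • e i) ↔
      Function.Bijective fun a : R => a • e 0 := by
  rw [← Function.Bijective.of_comp_iff _ (Equiv.funUnique (Fin 1) R).symm.bijective]
  refine iff_of_eq (congrArg _ (funext fun a => ?_))
  simp

theorem GModule.IsLineBundle.hasGenerators {𝓡 : GRing S} {L : GModule 𝓡} (hL : L.IsLineBundle) :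
    HasGenerators L := by
  intro x
  obtain ⟨U, hxU, e, he⟩ := hL x
  exact ⟨U, hxU, ⟨e 0, fun V hV => bijective_sum_fin_one.1 (he V hV)⟩⟩

theorem HasGluing.congr {F : S.X.Opens → Type u} {r r' : ∀ {U V : S.X.Opens}, V ≤ U → F U → F V}
    (h : HasGluing F r)
    (hr : ∀ (U V : S.X.Opens) (hVU : V ≤ U) (x : F U), r' hVU x = r hVU x) : HasGluing F r' := by
  intro ι U V hU hV s hs
  simp only [hr] at hs ⊢
  exact h ι U V hU hV s hs

variable {p : ℕ} [Fact p.Prime] {L : GModule (structureSheaf S)}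

variable (p L) in
/-- The sections and the restriction maps of the Teichmüller lift of a line bundle. -/
def teichLiftData : ModuleData (wittSheaf p S) where
  F U := wittFamily p L U
  module U := inferInstanceAs (Module (W₂ p ((structureSheaf S).sec U)) (wittFamily p L U))
  r h := wittFamily.restrict h
  r_self _ _ := rfl
  r_r _ _ _ := rfl
  r_smul {U V} h a w := (wittFamily.restrict_smul h a w).trans
    (congrArg (fun b : W₂ p ((structureSheaf S).sec V) => b • wittFamily.restrict h w)
      ((wittSheaf p S).act_one U V h (S.le_translate_one h) a))
  -- Families restrict their values through the action of 1, the sheaf W₂(𝒪_S) through its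
  -- restriction maps; `act_one` identifies the two.
  gluing := wittFamily.hasGluing <| (wittSheaf p S).hasGluing.congr fun U V h a =>
    (wittSheaf p S).act_one U V h (S.le_translate_one h) a

namespace TwistCocycle

variable (T : TwistCocycle p L)

/-- The Teichmüller lift of a line bundle, twisted by a cocycle. -/
def lift : GModule (wittSheaf p S) where
  M := (teichLiftData p L).toSheafOfModules
  act g _ _ h := T.act g h
  act_one _ _ hVU h x := T.act_one h hVU x
  act_mul g h _ _ _ h₁ h₂ h₃ x := T.act_mul g h h₁ h₂ h₃ x
  naive := by
    obtain ⟨N₁, hN₁⟩ := T.naive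
    obtain ⟨N₂, hN₂⟩ := isNaive_structureSheaf S
    obtain ⟨N₃, hN₃⟩ := L.naive
    refine ⟨N₁ ⊓ N₂ ⊓ N₃, fun g hg U V hVU h x => ?_⟩
    have hρ := (hN₂ g hg.1.2).1
    exact T.act_of_trivial (hN₁ g hg.1.1) h hVU (fun W => (S.translate_of_eq_one hρ W).ge)
      (fun W a => (hN₂ g hg.1.2).2 W _ a)
      (fun W x => (hN₃ g hg.2 W W le_rfl _ x).trans (res_self _ _ _)) x

/-- The reduction of the twisted Teichmüller lift of a line bundle. -/
def liftRed (hL : HasGenerators L) : RedHom p T.lift L where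
  app U := wittFamily.reduction hL U
  app_res _ _ h x := wittFamily.reduction_restrict hL h x
  app_act g _ _ h x := T.reduction_act hL g h x

/-- The section of the twisted Teichmüller lift defined by a generator. -/
def ofGen {U : S.X.Opens} (s : Gen L U) : msec T.lift.M U := wittFamily.ofGen s

theorem bijective_smul_ofGen {U V : S.X.Opens} (h : V ≤ U) (s : Gen L U) :
    Function.Bijective fun a : (wittSheaf p S).sec V => a • res T.lift.M h (T.ofGen s) :=
  wittFamily.bijective_smul_ofGen h s

theorem liftRed_ofGen (hL : HasGenerators L) {U V : S.X.Opens} (h : V ≤ U) (s : Gen L U) :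
    (T.liftRed hL).app V (res T.lift.M h (T.ofGen s)) = res L.M h s.1 :=
  wittFamily.reduction_restrict_ofGen hL h s

theorem isLineBundle_lift (hL : HasGenerators L) : T.lift.IsLineBundle := by
  intro x
  obtain ⟨U, hxU, ⟨s⟩⟩ := hL x
  exact ⟨U, hxU, fun _ => T.ofGen s, fun V hV =>
    bijective_sum_fin_one.2 (T.bijective_smul_ofGen hV s)⟩

theorem isLift_liftRed (hL : HasGenerators L) : (T.liftRed hL).IsLift := by
  intro x
  obtain ⟨U, hxU, ⟨s⟩⟩ := hL x
  refine ⟨U, hxU, fun V hV => isScalarExtension_of_bijective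
    (fun _ : Fin 1 => res T.lift.M hV (T.ofGen s))
    (bijective_sum_fin_one.2 (T.bijective_smul_ofGen hV s)) (bijective_sum_fin_one.2 ?_)⟩
  rw [T.liftRed_ofGen hL]
  exact s.2 V hV

end TwistCocycle

/-! ### Lifting geometrically split extensions -/

theorem GExtension.isLocallyFreeOfRank_two {𝓡 : GRing S} {L : GModule 𝓡} (hL : HasGenerators L)
    (𝓔 : GExtension L) (h𝓔 : 𝓔.IsGeometricallySplit) : 𝓔.E.IsLocallyFreeOfRank 2 := by
  obtain ⟨s, hs⟩ := h𝓔
  intro x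
  obtain ⟨U, hxU, ⟨t⟩⟩ := hL x
  refine ⟨U, hxU, ![mapp 𝓔.ι U t.1, unitHom s U 1], fun V hV => ?_⟩
  convert 𝓔.bijective_sum_smul hs (t.2 V hV) using 5 with a i
  have h1 : unitHom s V 1 = res 𝓔.E.M hV (unitHom s U 1) := by
    rw [unitHom_apply s hV, one_smul]
  fin_cases i
  · exact (mapp_res 𝓔.ι hV t.1).symm
  · exact h1.symm

/-! ### The reduction map between the two extensions. -/

section

variable {L₂ : GModule (wittSheaf p S)} (rL : RedHom p L₂ L) (𝓔 : GExtension L)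
  {s : SheafOfModules.unit (structureSheaf S).ringSheaf ⟶ 𝓔.E.M}
  (hs : s ≫ 𝓔.q = 𝟙 _) {c : G → msec L.M ⊤}
  (hc : ∀ g, 𝓔.E.act g ⊤ ⊤ (S.top_le_translate g) (unitHom s ⊤ 1) =
    mapp 𝓔.ι ⊤ (c g) + unitHom s ⊤ 1)
  {w : G → msec L₂.M ⊤} (hwc : ∀ g, rL.app ⊤ (w g) = c g)
  (hw : ∀ g h, w (g * h) = w g + L₂.act g ⊤ ⊤ (S.top_le_translate g) (w h))
  (hwN : ∃ N : OpenSubgroup G, ∀ g ∈ N, w g = 0)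

/-- The reduction map between two extensions, on sections. -/
def prodRed (s : SheafOfModules.unit (structureSheaf S).ringSheaf ⟶ 𝓔.E.M) (U : S.X.Opens) :
    (msec L₂.M U × (wittSheaf p S).sec U) →ₛₗ[wittRed p S U] msec 𝓔.E.M U where
  toFun x := mapp 𝓔.ι U (rL.app U x.1) + unitHom s U (wittRed p S U x.2)
  map_add' x y := by
    change mapp 𝓔.ι U (rL.app U (x.1 + y.1)) + unitHom s U (wittRed p S U (x.2 + y.2)) = _
    rw [map_add, map_add, map_add, map_add]
    abel
  map_smul' a x := by
    change mapp 𝓔.ι U (rL.app U (a • x.1)) + unitHom s U (wittRed p S U (a * x.2)) = _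
    rw [map_smulₛₗ, map_smul, map_mul, ← smul_eq_mul, map_smul, smul_add]

/-- The reduction map from the extension defined by a lift of the cocycle of an extension. -/
def extensionRed : RedHom p (GExtension.ofCocycle L₂ hw hwN (isNaive_wittSheaf p S)).E 𝓔.E where
  app U := prodRed rL 𝓔 s U
  app_res U V h x := by
    change mapp 𝓔.ι V (rL.app V (res L₂.M h x.1)) +
        unitHom s V (wittRed p S V ((wittSheaf p S).R.obj.map (homOfLE h).op x.2)) =
      res 𝓔.E.M h (mapp 𝓔.ι U (rL.app U x.1) + unitHom s U (wittRed p S U x.2))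
    rw [map_add, ← mapp_res, rL.app_res]
    exact congrArg (_ + ·) (mapp_res s h (wittRed p S U x.2))
  app_act g U V h x := by
    change mapp 𝓔.ι V (rL.app V (L₂.act g U V h x.1 +
        (wittSheaf p S).act g U V h x.2 • res L₂.M le_top (w g))) +
        unitHom s V (wittRed p S V ((wittSheaf p S).act g U V h x.2)) =
      𝓔.E.act g U V h (mapp 𝓔.ι U (rL.app U x.1) + unitHom s U (wittRed p S U x.2))
    have h1 : wittRed p S V ((wittSheaf p S).act g U V h x.2) =
        (structureSheaf S).act g U V h (wittRed p S U x.2) := W₂.red_map _ _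
    rw [map_add, map_add, map_smulₛₗ, rL.app_act, rL.app_res, hwc, h1, map_add,
      𝓔.act_section (hc g), 𝓔.ι_equivariant]
    abel

-- Locally the basis ι(t), s(1) of the new middle term reduces to the basis ι(t'), s(1) of the old
-- one.
include hs in
theorem isLift_extensionRed (hrL : ∀ x : S.X, ∃ U : S.X.Opens, x ∈ U ∧
    ∃ (t : Gen L₂ U) (t' : Gen L U), rL.app U t.1 = t'.1) :
    (extensionRed rL 𝓔 hc hwc hw hwN).IsLift := by
  intro x
  obtain ⟨U, hxU, t, t', ht⟩ := hrL x
  refine ⟨U, hxU, fun V hV => ?_⟩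
  set 𝓔₂ := GExtension.ofCocycle L₂ hw hwN (isNaive_wittSheaf p S)
  refine isScalarExtension_of_bijective
    ![mapp 𝓔₂.ι V (res L₂.M hV t.1), unitHom (GExtension.prodInr L₂) V 1]
    (𝓔₂.bijective_sum_smul (GExtension.prodInr_prodSnd L₂) (t.2 V hV)) ?_
  convert 𝓔.bijective_sum_smul hs (t'.2 V hV) using 5 with a i
  fin_cases i
  · change mapp 𝓔.ι V (rL.app V (res L₂.M hV t.1)) + unitHom s V (wittRed p S V 0) =
      mapp 𝓔.ι V (res L.M hV t'.1)
    rw [map_zero, map_zero, add_zero, rL.app_res, ht]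
  · change mapp 𝓔.ι V (rL.app V 0) + unitHom s V (wittRed p S V 1) = unitHom s V 1
    rw [map_zero, map_zero, zero_add, map_one (wittRed p S V)]

end

end

end GWitt

end

/-! ### The lifting theorem. -/

open GWitt in
theorem mainTheorem6 (p : ℕ) [Fact p.Prime]
    (G : Type v) [Group G] [TopologicalSpace G] [IsTopologicalGroup G] [CompactSpace G]
    [TotallyDisconnectedSpace G]
    (hG : IsOneOneSmooth.{v, u} G p)
    (S : GScheme.{v, u} G) (hchar : S.IsOfChar p) (hperf : S.IsPerfect p)
    (L₁ : GModule (structureSheaf S)) (hL₁ : L₁.IsLineBundle)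
    (𝓔₁ : GExtension L₁) (hE₁ : 𝓔₁.E.IsVectorBundle) (hsplit : 𝓔₁.IsGeometricallySplit) :
    ∃ (L₂ : GModule (wittSheaf p S)) (rL : RedHom p L₂ L₁),
      L₂.IsLineBundle ∧ rL.IsLift ∧
      ∃ (𝓔₂ : GExtension L₂) (rE : RedHom p 𝓔₂.E 𝓔₁.E),
        𝓔₂.E.IsVectorBundle ∧ 𝓔₂.IsGeometricallySplit ∧ rE.IsLift ∧
        (∀ (U : S.X.Opens) (x : msec L₂.M U),
          rE.app U (mapp 𝓔₂.ι U x) = mapp 𝓔₁.ι U (rL.app U x)) ∧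
        (∀ (U : S.X.Opens) (y : msec 𝓔₂.E.M U),
          mapp 𝓔₁.q U (rE.app U y) = wittRed p S U (mapp 𝓔₂.q U y)) := by
  obtain ⟨s, hs⟩ := hsplit
  have hL := hL₁.hasGenerators
  obtain ⟨c, hc, hc', hcN⟩ := 𝓔₁.exists_cocycle hs
  obtain ⟨u, w, hu, hu', hu'', hw, hw', hw'', N, hN⟩ :=
    hG.exists_twist_family (𝓡 := structureSheaf S) (L := L₁) hperf hchar
      (isNaive_structureSheaf S) hc' hcN
  -- The degree zero part u twists the action on the Teichmüller lift, and for this twisted action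
  -- the degree one part w is a cocycle of global sections lifting c.
  let T : TwistCocycle p L₁ := ⟨u, hu, hu', hu'', N, fun g hg => (hN g hg).1⟩
  let w₂ : G → msec T.lift.M ⊤ := fun g => (⟨w g, hw g⟩ : wittFamily p L₁ ⊤)
  have hwc (g : G) : (T.liftRed hL).app ⊤ (w₂ g) = c g :=
    wittFamily.reduction_eq hL fun V hV s => hw' g ⟨V, hV⟩ s
  have hw₂ (g h : G) :
      w₂ (g * h) = w₂ g + T.lift.act g ⊤ ⊤ (S.top_le_translate g) (w₂ h) :=
    Subtype.ext (hw'' g h)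
  have hwN : ∃ N : OpenSubgroup G, ∀ g ∈ N, w₂ g = 0 :=
    ⟨N, fun g hg => Subtype.ext (hN g hg).2⟩
  have hL₂ := T.isLineBundle_lift hL
  let 𝓔₂ := GExtension.ofCocycle T.lift hw₂ hwN (isNaive_wittSheaf p S)
  have h𝓔₂ : 𝓔₂.IsGeometricallySplit := ⟨_, GExtension.prodInr_prodSnd T.lift⟩
  refine ⟨T.lift, T.liftRed hL, hL₂, T.isLift_liftRed hL, 𝓔₂,
    extensionRed (T.liftRed hL) 𝓔₁ hc hwc hw₂ hwN,
    ⟨2, 𝓔₂.isLocallyFreeOfRank_two hL₂.hasGenerators h𝓔₂⟩, h𝓔₂,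
    isLift_extensionRed _ 𝓔₁ hs hc hwc hw₂ hwN fun x => ?_, fun U x => ?_, fun U y => ?_⟩
  · obtain ⟨U, hxU, ⟨t⟩⟩ := hL x
    refine ⟨U, hxU, ⟨T.ofGen t, fun V hV => T.bijective_smul_ofGen hV t⟩, t, ?_⟩
    have h1 := T.liftRed_ofGen hL le_rfl t
    rwa [res_self, res_self] at h1
  · change mapp 𝓔₁.ι U ((T.liftRed hL).app U x) + unitHom s U (wittRed p S U 0) = _
    rw [map_zero, map_zero, add_zero]
  · change homUnit 𝓔₁.q U (mapp 𝓔₁.ι U ((T.liftRed hL).app U y.1) +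
      unitHom s U (wittRed p S U y.2)) = wittRed p S U y.2
    rw [map_add, 𝓔₁.q_ι, 𝓔₁.q_section hs, zero_add]
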